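/- **Definitions.** A signed graph $\Sigma$ is a loopless graph each of whose edges has a sign $+1$ or $-1$; two edges with opposite signs may join the same pair of vertices, two edges with the same sign may not. A proper coloring of $\Sigma$ is a map $f\colon V(\Sigma)\to\mathbb{Z}$ such that $f(u)\neq \varepsilon f(v)$ whenever $u$ and $v$ are joined by an edge of sign $\varepsilon$. A zero-free list assignment $L$ assigns to each vertex $v$ a set $L(v)\subseteq\mathbb{Z}\setminus\{0\}$, and $\Sigma$ is $L$-colorable if it has a proper coloring $f$ with $f(v)\in L(v)$ for every vertex $v$. The zero-free list chromatic number $\chi^*_l(\Sigma)$ is the minimum even integer $2m\ge 0$ such that $\Sigma$ is $L$-colorable for every zero-free list assignment $L$ with $|L(v)|\ge 2m$ for all $v\in V(\Sigma)$. The complete expansion of a simple graph $G$ is the signed graph on $V(G)$ in which each edge of $G$ is a positive edge and, in addition, every two distinct vertices (adjacent in $G$ or not) are joined by a negative edge. A complete $k$-partite graph is a simple graph whose vertex set is partitioned into $k$ nonempty parts, two vertices being adjacent if and only if they lie in different parts. **Theorem.** Let $G$ be a complete $k$-partite graph with at most $2k+1$ vertices, and let $\Sigma$ be the complete expansion of $G$.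 Then $\chi^*_l(\Sigma)=2k$. -/

import Mathlib

/-- A signed graph on the vertex set `V`: a loopless graph whose edges carry a sign `+1` or `-1`.
Two edges of opposite signs may join the same pair of vertices, two edges of the same sign may not;
hence the edges are given by saying, for each sign `ε`, which pairs are joined by an edge of
sign `ε`. -/
structure SignedGraph (V : Type*) where
  /-- `Adj ε u v`: the vertices `u` and `v` are joined by an edge of sign `ε`. -/
  Adj : ℤˣ → V → V → Prop
  symm : ∀ ε u v, Adj ε u v → Adj ε v u
  loopless : ∀ ε v, ¬ Adj ε v v

namespace SignedGraph

/-- `f` is a proper coloring (by integers): `f u ≠ σ(e) f v` for each edge `e` joining `u`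
and `v`. -/
def IsProperColoring {V : Type*} (S : SignedGraph V) (f : V → ℤ) : Prop :=
  ∀ (ε : ℤˣ) (u v : V), S.Adj ε u v → f u ≠ (ε : ℤ) * f v

/-- `L` is a zero-free list assignment: every `L v` is a set of nonzero integers. -/
def IsZeroFreeListAssignment {V : Type*} (L : V → Set ℤ) : Prop :=
  ∀ v, (0 : ℤ) ∉ L v

/-- The signed graph has a proper coloring `f` with `f v ∈ L v` for all `v`. -/
def IsListColorable {V : Type*} (S : SignedGraph V) (L : V → Set ℤ) : Prop :=
  ∃ f : V → ℤ, S.IsProperColoring f ∧ ∀ v, f v ∈ L v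

/-- The signed graph is `L`-colorable for every zero-free list assignment `L` all of whose lists
have at least `n` elements (the lists may be infinite). -/
def IsZeroFreeChoosable {V : Type*} (S : SignedGraph V) (n : ℕ) : Prop :=
  ∀ L : V → Set ℤ, IsZeroFreeListAssignment L → (∀ v, (n : ℕ∞) ≤ (L v).encard) →
    S.IsListColorable L

/-- The zero-free list chromatic number: the minimum even number `2 * k` such that the signed graph
is `L`-colorable for every zero-free list assignment `L` with lists of size at least `2 * k`
(and `⊤` if there is no such number). -/
noncomputable def zeroFreeListChromaticNumber {V : Type*} (S : SignedGraph V) : ℕ∞ :=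
  ⨅ k ∈ {k : ℕ | S.IsZeroFreeChoosable (2 * k)}, ((2 * k : ℕ) : ℕ∞)

end SignedGraph

/-- The complete expansion of a graph: each edge of the graph is taken as a positive edge, and a
negative edge is added between each pair of distinct vertices (adjacent or not). -/
def SimpleGraph.completeExpansion {V : Type*} (G : SimpleGraph V) : SignedGraph V where
  Adj ε u v := (ε = 1 ∧ G.Adj u v) ∨ (ε = -1 ∧ u ≠ v)
  symm := by
    rintro ε u v (⟨h, huv⟩ | ⟨h, huv⟩)
    · exact Or.inl ⟨h, huv.symm⟩
    · exact Or.inr ⟨h, huv.symm⟩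
  loopless := by
    rintro ε v (⟨-, h⟩ | ⟨-, h⟩)
    · exact h.ne rfl
    · exact h rfl

/-- `G` is a complete `k`-partite graph: its vertex set is partitioned into `k` nonempty parts, and
two vertices are adjacent exactly when they lie in different parts. -/
def SimpleGraph.IsCompletePartite {V : Type*} (G : SimpleGraph V) (k : ℕ) : Prop :=
  ∃ part : V → Fin k, Function.Surjective part ∧ ∀ u v, G.Adj u v ↔ part u ≠ part v

/-! Lower bound: a transversal of the parts is a clique in both signs, so its k colors have distinct
absolute values, and the lists {±1, …, ±m} force k ≤ m.

Upper bound: a color is an absolute value ("value" below) with a sign. The negative edges allow each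
value to occur with one sign only, and the positive edges confine it to one part. So the vertices
must be divided into classes inside the parts, and the classes given distinct values, each with a
sign available throughout its class. This is a Hall problem; the argument adapts the proof of Ohba's
conjecture by Noel, Reed and Wu, each value counting for two colors.

Take a minimal counterexample with n vertices and set C of values. Coloring some vertices and
applying minimality to the rest shows that a part with at least two vertices has no common color,
and that |C| < n (`card_palette_lt`). A value is frequent if it occurs more than 2k times; counting
occurrences gives at least n - |C| frequent values. A Hall violator that contains a singleton class
sees every frequent value (`frequent_subset_of_violator`). Hence a singleton class may be labelled
by a frequent value even if its list lacks it (`false_of_near_acceptable`).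

If at least n - |C| parts have three or more vertices, merging a suitable pair in each of n - |C| of
them leaves |C| classes that satisfy Hall's condition (`card_partsOfCard_three_lt`). Otherwise
frequent values, together with private values for singleton parts, form a reserve at least as large
as the number of parts. A maximal partial coloring avoiding the reserve then leaves few enough
vertices to be labelled from it (`false_of_maximal_partialColoring`). -/

/-! ### Hall's theorem and minimal violators -/

/-- Hall's theorem for a finite family indexed by a finset. -/
theorem Finset.exists_injOn_of_hall {ι β : Type*} [DecidableEq β] [Nonempty β] (s : Finset ι)
    (t : ι → Finset β) (h : ∀ u ⊆ s, u.card ≤ (u.biUnion t).card) :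
    ∃ f : ι → β, Set.InjOn f s ∧ ∀ i ∈ s, f i ∈ t i := by
  classical
  obtain ⟨f, hf, hft⟩ := (Finset.all_card_le_biUnion_card_iff_exists_injective
    (fun i : s => t i)).1 (fun u => by
      have := h (u.map (Function.Embedding.subtype _)) (by
        intro x hx
        simp only [Finset.mem_map, Function.Embedding.subtype_apply] at hx
        obtain ⟨a, -, rfl⟩ := hx
        exact a.2)
      rw [Finset.card_map] at this
      refine this.trans (Finset.card_le_card ?_)
      intro x hx
      simp only [Finset.mem_biUnion, Finset.mem_map, Function.Embedding.subtype_apply] at hx ⊢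
      obtain ⟨_, ⟨a, ha, rfl⟩, hx⟩ := hx
      exact ⟨a, ha, hx⟩)
  refine ⟨fun i => if hi : i ∈ s then f ⟨i, hi⟩ else Classical.arbitrary β, ?_, ?_⟩
  · intro i hi j hj hij
    rw [Finset.mem_coe] at hi hj
    simp only [hi, hj, dif_pos] at hij
    exact congrArg Subtype.val (hf hij)
  · intro i hi
    simp only [hi, dif_pos]
    exact hft ⟨i, hi⟩

theorem Finset.exists_injOn_of_card_le {ι β : Type*} [DecidableEq β] [Nonempty β] (s : Finset ι)
    (t : ι → Finset β) (h : ∀ i ∈ s, s.card ≤ (t i).card) :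
    ∃ f : ι → β, Set.InjOn f s ∧ ∀ i ∈ s, f i ∈ t i := by
  refine s.exists_injOn_of_hall t fun u hu => ?_
  rcases u.eq_empty_or_nonempty with rfl | ⟨i, hi⟩
  · simp
  · exact (Finset.card_le_card hu).trans ((h i (hu hi)).trans
      (Finset.card_le_card (Finset.subset_biUnion_of_mem t hi)))

/-- A minimal violator of Hall's condition: after removing any of its elements, it is matched
perfectly to its neighbourhood. -/
theorem Finset.exists_minimal_hall_violator {ι β : Type*} [DecidableEq ι] [DecidableEq β]
    [Nonempty β] (s : Finset ι)
    (t : ι → Finset β) (h : ∃ u ⊆ s, (u.biUnion t).card < u.card) :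
    ∃ u ⊆ s, u.Nonempty ∧ (u.biUnion t).card + 1 = u.card ∧ ∀ e ∈ u, ∃ f : ι → β,
      Set.InjOn f (u.erase e) ∧ (∀ i ∈ u.erase e, f i ∈ t i) ∧
        (u.erase e).image f = u.biUnion t := by
  obtain ⟨u, hu, hmin⟩ := (s.powerset.filter fun u => (u.biUnion t).card < u.card).exists_min_image
    Finset.card (by
      obtain ⟨u, hus, hu⟩ := h
      exact ⟨u, by simp [hus, hu]⟩)
  simp only [Finset.mem_filter, Finset.mem_powerset, and_imp] at hu hmin
  obtain ⟨hus, hlt⟩ := hu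
  have hne : u.Nonempty := by
    rw [← Finset.card_pos]
    omega
  have key : ∀ e ∈ u, ∃ f : ι → β, Set.InjOn f (u.erase e) ∧ (∀ i ∈ u.erase e, f i ∈ t i) ∧
        (u.erase e).image f = u.biUnion t := by
    intro e he
    -- By minimality `u.erase e` satisfies Hall's condition; its |u| - 1 representatives then
    -- exhaust the neighbourhood of `u`.
    obtain ⟨f, hf, hft⟩ := (u.erase e).exists_injOn_of_hall t (by
      intro v hv
      by_contra! hcon
      have h1 := hmin v (hv.trans ((u.erase_subset e).trans hus)) hcon
      have h2 := Finset.card_le_card hv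
      have h3 := Finset.card_erase_lt_of_mem he
      omega)
    refine ⟨f, hf, hft, Finset.eq_of_subset_of_card_le ?_ ?_⟩
    · intro b hb
      obtain ⟨i, hi, rfl⟩ := Finset.mem_image.1 hb
      exact Finset.mem_biUnion.2 ⟨i, Finset.mem_of_mem_erase hi, hft i hi⟩
    · rw [Finset.card_image_of_injOn hf, Finset.card_erase_of_mem he]
      omega
  refine ⟨u, hus, hne, ?_, key⟩
  obtain ⟨e, he⟩ := hne
  obtain ⟨f, hf, -, himg⟩ := key e he
  rw [← himg, Finset.card_image_of_injOn hf, Finset.card_erase_of_mem he]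
  have := Finset.card_pos.2 ⟨e, he⟩
  omega

set_option linter.unusedSectionVars false

/-! ### Signed colors, minimal counterexamples and reductions -/

namespace PartiteColoring

variable {V ι α : Type*} [DecidableEq V] [DecidableEq ι] [DecidableEq α]

/-- A list coloring, on the vertex set `s`, of the complete expansion of the complete multipartite
graph with parts the fibers of `part`. The colors are pairs of an absolute value and a sign. -/
def IsPartialColoring (part : V → ι) (L : V → Finset (α × Bool)) (s : Finset V)
    (f : V → α × Bool) : Prop :=
  (∀ v ∈ s, f v ∈ L v) ∧
    ∀ u ∈ s, ∀ v ∈ s, (f u).1 = (f v).1 → part u = part v ∧ f u = f v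

/-- There is a list coloring on the vertex set `s`. -/
def Colorable (part : V → ι) (L : V → Finset (α × Bool)) (s : Finset V) : Prop :=
  ∃ f, IsPartialColoring part L s f

/-- The absolute values of the colors in the list of `v`. -/
def absList (L : V → Finset (α × Bool)) (v : V) : Finset α :=
  (L v).image Prod.fst

/-- The absolute values of all available colors. -/
def palette (L : V → Finset (α × Bool)) (s : Finset V) : Finset α :=
  s.biUnion (absList L)

/-- The vertices whose list contains a color of absolute value `c`. -/
def holders (L : V → Finset (α × Bool)) (s : Finset V) (c : α) : Finset V :=
  s.filter fun v => c ∈ absList L v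

/-- The number of occurrences in the lists of colors of absolute value `c`. -/
def weight (L : V → Finset (α × Bool)) (s : Finset V) (c : α) : ℕ :=
  ∑ v ∈ s, ((L v).filter fun χ => χ.1 = c).card

/-- The absolute values that occur more than `2 * k` times in the lists. -/
def frequent (L : V → Finset (α × Bool)) (s : Finset V) (k : ℕ) : Finset α :=
  (palette L s).filter fun c => 2 * k < weight L s c

/-- The vertices of `s` in the part `i`. -/
def fiber (part : V → ι) (s : Finset V) (i : ι) : Finset V :=
  s.filter fun v => part v = i

theorem mem_absList {L : V → Finset (α × Bool)} {v : V} {c : α} :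
    c ∈ absList L v ↔ ∃ ε, (c, ε) ∈ L v := by
  simp [absList]

theorem mem_absList_of_mem {L : V → Finset (α × Bool)} {v : V} {χ : α × Bool} (h : χ ∈ L v) :
    χ.1 ∈ absList L v :=
  Finset.mem_image_of_mem _ h

theorem mem_palette {L : V → Finset (α × Bool)} {s : Finset V} {c : α} :
    c ∈ palette L s ↔ ∃ v ∈ s, c ∈ absList L v := by
  simp [palette]

theorem absList_subset_palette {L : V → Finset (α × Bool)} {s : Finset V} {v : V} (hv : v ∈ s) :
    absList L v ⊆ palette L s :=
  Finset.subset_biUnion_of_mem _ hv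

theorem mem_holders {L : V → Finset (α × Bool)} {s : Finset V} {c : α} {v : V} :
    v ∈ holders L s c ↔ v ∈ s ∧ c ∈ absList L v := by
  simp [holders]

theorem mem_fiber {part : V → ι} {s : Finset V} {i : ι} {v : V} :
    v ∈ fiber part s i ↔ v ∈ s ∧ part v = i := by
  simp [fiber]

theorem fiber_subset (part : V → ι) (s : Finset V) (i : ι) : fiber part s i ⊆ s :=
  Finset.filter_subset _ _

/-- A set of colors with absolute values in `D` has at most `2 * |D|` elements. -/
theorem card_le_of_fst_mem {M : Finset (α × Bool)} {D : Finset α} (h : ∀ χ ∈ M, χ.1 ∈ D) :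
    M.card ≤ 2 * D.card := by
  have : M ⊆ D ×ˢ (Finset.univ : Finset Bool) := fun χ hχ => by simp [h χ hχ]
  have := Finset.card_le_card this
  simp only [Finset.card_product, Finset.card_univ, Fintype.card_bool] at this
  omega

theorem card_list_le (L : V → Finset (α × Bool)) (v : V) :
    (L v).card ≤ 2 * (absList L v).card :=
  card_le_of_fst_mem fun _ hχ => mem_absList_of_mem hχ

/-- A vertex set that is not colorable although the counting conditions hold, minimal with this
property. -/
structure MinimalCounterexample (part : V → ι) (L : V → Finset (α × Bool)) (s : Finset V)
    (k : ℕ) : Prop where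
  card_parts : (s.image part).card ≤ k
  card_le : s.card ≤ 2 * k + 1
  card_list : ∀ v ∈ s, 2 * k ≤ (L v).card
  -- Lists and `k'` are arbitrary here, since the reductions shrink the lists and lower `k`.
  minimal : ∀ t ⊂ s, ∀ (L' : V → Finset (α × Bool)) (k' : ℕ), (t.image part).card ≤ k' →
    t.card ≤ 2 * k' + 1 → (∀ v ∈ t, 2 * k' ≤ (L' v).card) → Colorable part L' t
  not_colorable : ¬ Colorable part L s

namespace MinimalCounterexample

variable {part : V → ι} {L : V → Finset (α × Bool)} {s : Finset V} {k : ℕ}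

theorem le_card_absList (h : MinimalCounterexample part L s k) {v : V} (hv : v ∈ s) :
    k ≤ (absList L v).card := by
  have h1 := h.card_list v hv
  have h2 := card_list_le L v
  omega

/-- The values in `O` are deleted from the lists outside `X`. Each costs a list at most two colors,
so minimality applies with `k - j`. Values in `D` need no deletion, as they do not occur there. -/
theorem false_of_extension (h : MinimalCounterexample part L s k) {X : Finset V} (hXs : X ⊆ s)
    (hX : X.Nonempty) {f : V → α × Bool} (hf : IsPartialColoring part L X f) (D O : Finset α)
    (j : ℕ) (hDO : ∀ v ∈ X, (f v).1 ∈ D ∪ O) (hD : ∀ v ∈ s \ X, ∀ χ ∈ L v, χ.1 ∉ D)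
    (hO : O.card ≤ j) (hparts : ((s \ X).image part).card + j ≤ k)
    (hcard : (s \ X).card + 2 * j ≤ 2 * k + 1) : False := by
  obtain ⟨g, hgL, hg⟩ := h.minimal (s \ X) (Finset.sdiff_ssubset hXs hX)
    (fun v => (L v).filter fun χ => χ.1 ∉ O) (k - j) (by omega) (by omega) (by
      intro v hv
      have h1 := h.card_list v (Finset.mem_sdiff.1 hv).1
      have h2 := Finset.card_filter_add_card_filter_not (s := L v) (fun χ => χ.1 ∈ O)
      have h3 := card_le_of_fst_mem (M := (L v).filter fun χ => χ.1 ∈ O) (D := O) (by simp)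
      omega)
  simp only [Finset.mem_filter] at hgL
  have hne : ∀ u ∈ X, ∀ v ∈ s \ X, (f u).1 ≠ (g v).1 := by
    intro u hu v hv huv
    have h1 := hDO u hu
    rw [huv, Finset.mem_union] at h1
    rcases h1 with h1 | h1
    · exact hD v hv _ (hgL v hv).1 h1
    · exact (hgL v hv).2 h1
  refine h.not_colorable ⟨fun v => if v ∈ X then f v else g v, ?_, ?_⟩
  · intro v hv
    by_cases hvX : v ∈ X
    · simp only [hvX, if_true]
      exact hf.1 v hvX
    · simp only [hvX, if_false]
      exact (hgL v (Finset.mem_sdiff.2 ⟨hv, hvX⟩)).1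
  · intro u hu v hv huv
    by_cases huX : u ∈ X <;> by_cases hvX : v ∈ X <;>
      simp only [huX, hvX, if_true, if_false] at huv ⊢
    · exact hf.2 u huX v hvX huv
    · exact absurd huv (hne u huX v (Finset.mem_sdiff.2 ⟨hv, hvX⟩))
    · exact absurd huv.symm (hne v hvX u (Finset.mem_sdiff.2 ⟨hu, huX⟩))
    · exact hg u (Finset.mem_sdiff.2 ⟨hu, huX⟩) v (Finset.mem_sdiff.2 ⟨hv, hvX⟩) huv

/-- A common color could be used on the whole part. That removes one part, at least two vertices and
one value, so the extension applies with `j = 1`. -/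
theorem not_forall_fiber_mem (h : MinimalCounterexample part L s k) {i : ι}
    (hi : 2 ≤ (fiber part s i).card) (χ : α × Bool) : ∃ v ∈ fiber part s i, χ ∉ L v := by
  by_contra! hχ
  obtain ⟨v, hv⟩ : (fiber part s i).Nonempty := by
    rw [← Finset.card_pos]
    omega
  have hsub := fiber_subset part s i
  have hparts : ((s \ fiber part s i).image part) ⊆ (s.image part).erase i := by
    intro x hx
    simp only [Finset.mem_image, Finset.mem_sdiff, mem_fiber, Finset.mem_erase] at hx ⊢
    obtain ⟨w, ⟨hw, hwi⟩, rfl⟩ := hx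
    exact ⟨fun hwi' => hwi ⟨hw, hwi'⟩, w, hw, rfl⟩
  have hmem : i ∈ s.image part :=
    Finset.mem_image.2 ⟨v, (mem_fiber.1 hv).1, (mem_fiber.1 hv).2⟩
  have h1 := Finset.card_le_card hparts
  rw [Finset.card_erase_of_mem hmem] at h1
  have h2 := h.card_parts
  have h3 := Finset.card_pos.2 ⟨i, hmem⟩
  have h4 := Finset.card_sdiff_add_card_eq_card hsub
  have h5 := h.card_le
  refine h.false_of_extension hsub ⟨v, hv⟩ (f := fun _ => χ) ⟨hχ, ?_⟩ ∅ {χ.1} 1 (by simp)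
    (by simp) (by simp) (by omega) (by omega)
  intro u hu w hw _
  exact ⟨(mem_fiber.1 hu).2.trans (mem_fiber.1 hw).2.symm, rfl⟩

theorem nonempty [Nonempty α] (h : MinimalCounterexample part L s k) : s.Nonempty := by
  rw [Finset.nonempty_iff_ne_empty]
  rintro rfl
  exact h.not_colorable ⟨fun _ => (Classical.arbitrary α, true), by simp [IsPartialColoring]⟩

/-- If this fails, a minimal violator less one element is matched onto all its holders. Coloring
these vertices accordingly uses values that occur nowhere else, so the extension applies with `j =
0`. -/
theorem card_le_card_biUnion_holders [Nonempty α] (h : MinimalCounterexample part L s k)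
    {D : Finset α} (hD : D ⊆ palette L s) : D.card ≤ (D.biUnion (holders L s)).card := by
  obtain ⟨v₀, -⟩ := h.nonempty
  have : Nonempty V := ⟨v₀⟩
  by_contra! hcon
  obtain ⟨u, hus, ⟨e, he⟩, -, hu⟩ := (palette L s).exists_minimal_hall_violator (holders L s)
    ⟨D, hD, hcon⟩
  obtain ⟨f, hf, hft, himg⟩ := hu e he
  have hch : ∀ v ∈ u.biUnion (holders L s), ∃ χ ∈ L v, χ.1 ∈ u ∧ f χ.1 = v := by
    intro v hv
    rw [← himg, Finset.mem_image] at hv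
    obtain ⟨c, hc, rfl⟩ := hv
    obtain ⟨ε, hε⟩ := mem_absList.1 (mem_holders.1 (hft c hc)).2
    exact ⟨(c, ε), hε, Finset.mem_of_mem_erase hc, rfl⟩
  choose! g hgL hgu hfg using hch
  have hsub : u.biUnion (holders L s) ⊆ s := by
    intro v hv
    obtain ⟨c, -, hc⟩ := Finset.mem_biUnion.1 hv
    exact (mem_holders.1 hc).1
  have hne : (u.biUnion (holders L s)).Nonempty := by
    obtain ⟨v, hv, hev⟩ := mem_palette.1 (hus he)
    exact ⟨v, Finset.mem_biUnion.2 ⟨e, he, mem_holders.2 ⟨hv, hev⟩⟩⟩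
  refine h.false_of_extension hsub hne (f := g) ⟨hgL, ?_⟩ u ∅ 0 (by simpa using hgu) ?_ (by simp)
    ?_ ?_
  · intro v hv w hw hvw
    have : v = w := by rw [← hfg v hv, ← hfg w hw, hvw]
    subst this
    exact ⟨rfl, rfl⟩
  · intro v hv χ hχ hχu
    rw [Finset.mem_sdiff] at hv
    exact hv.2 (Finset.mem_biUnion.2 ⟨χ.1, hχu, mem_holders.2 ⟨hv.1, mem_absList_of_mem hχ⟩⟩)
  · exact (Finset.card_le_card (Finset.image_subset_image Finset.sdiff_subset)).trans h.card_parts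
  · exact (Finset.card_le_card Finset.sdiff_subset).trans h.card_le

/-- With |s| or more values, matching values to holders would reach every vertex, and each vertex
would have a value of its own. -/
theorem card_palette_lt [Nonempty α] (h : MinimalCounterexample part L s k) :
    (palette L s).card < s.card := by
  obtain ⟨v₀, -⟩ := h.nonempty
  have : Nonempty V := ⟨v₀⟩
  by_contra! hcon
  obtain ⟨f, hf, hft⟩ := (palette L s).exists_injOn_of_hall (holders L s)
    fun D hD => h.card_le_card_biUnion_holders hD
  have himg : (palette L s).image f = s := by
    refine Finset.eq_of_subset_of_card_le ?_ ?_
    · intro v hv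
      obtain ⟨c, hc, rfl⟩ := Finset.mem_image.1 hv
      exact (mem_holders.1 (hft c hc)).1
    · rwa [Finset.card_image_of_injOn hf]
  have hch : ∀ v ∈ s, ∃ χ ∈ L v, f χ.1 = v := by
    intro v hv
    rw [← himg, Finset.mem_image] at hv
    obtain ⟨c, hc, rfl⟩ := hv
    obtain ⟨ε, hε⟩ := mem_absList.1 (mem_holders.1 (hft c hc)).2
    exact ⟨(c, ε), hε, rfl⟩
  choose! g hgL hfg using hch
  refine h.not_colorable ⟨g, hgL, ?_⟩
  intro v hv w hw hvw
  have : v = w := by rw [← hfg v hv, ← hfg w hw, hvw]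
  subst this
  exact ⟨rfl, rfl⟩

end MinimalCounterexample

end PartiteColoring

/-! ### Frequent values and Hall's condition for classes -/

namespace PartiteColoring

variable {V ι α κ : Type*} [DecidableEq V] [DecidableEq ι] [DecidableEq α] [DecidableEq κ]

/-- The absolute values `c` such that, with one sign, `c` is available at every vertex of the
class `l` of the labelling `q`. -/
def classColors (L : V → Finset (α × Bool)) (s : Finset V) (q : V → κ) (l : κ) : Finset α :=
  (palette L s).filter fun c => ∃ ε, ∀ v ∈ s, q v = l → (c, ε) ∈ L v

/-- The parts with at least `m` vertices in `s`. -/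
def partsOfCard (part : V → ι) (s : Finset V) (m : ℕ) : Finset ι :=
  (s.image part).filter fun i => m ≤ (fiber part s i).card

theorem mem_classColors {L : V → Finset (α × Bool)} {s : Finset V} {q : V → κ} {l : κ} {c : α}
    (hl : l ∈ s.image q) :
    c ∈ classColors L s q l ↔ ∃ ε, ∀ v ∈ s, q v = l → (c, ε) ∈ L v := by
  simp only [classColors, Finset.mem_filter, and_iff_right_iff_imp]
  rintro ⟨ε, hε⟩
  obtain ⟨v, hv, rfl⟩ := Finset.mem_image.1 hl
  exact mem_palette.2 ⟨v, hv, mem_absList.2 ⟨ε, hε v hv rfl⟩⟩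

theorem mem_partsOfCard {part : V → ι} {s : Finset V} {m : ℕ} (hm : 1 ≤ m) {i : ι} :
    i ∈ partsOfCard part s m ↔ m ≤ (fiber part s i).card := by
  simp only [partsOfCard, Finset.mem_filter, and_iff_right_iff_imp]
  intro hi
  obtain ⟨v, hv⟩ : (fiber part s i).Nonempty := by
    rw [← Finset.card_pos]
    omega
  exact Finset.mem_image.2 ⟨v, (mem_fiber.1 hv).1, (mem_fiber.1 hv).2⟩

theorem card_eq_sum_fiber (part : V → ι) (s : Finset V) :
    s.card = ∑ i ∈ s.image part, (fiber part s i).card :=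
  Finset.card_eq_sum_card_image part s

/-- If Hall's condition holds for the labels, then there is a coloring that is constant on each
class of the labelling. -/
theorem colorable_of_hall_classes [Nonempty α] {part : V → ι} {L : V → Finset (α × Bool)}
    {s : Finset V} (q : V → κ) (hq : ∀ u ∈ s, ∀ v ∈ s, q u = q v → part u = part v)
    (hall : ∀ U ⊆ s.image q, U.card ≤ (U.biUnion (classColors L s q)).card) :
    Colorable part L s := by
  obtain ⟨f, hf, hft⟩ := (s.image q).exists_injOn_of_hall _ hall
  have : ∀ l ∈ s.image q, ∃ ε, ∀ v ∈ s, q v = l → (f l, ε) ∈ L v := fun l hl =>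
    (mem_classColors hl).1 (hft l hl)
  choose! e he using this
  refine ⟨fun v => (f (q v), e (q v)), fun v hv => he _ (Finset.mem_image_of_mem q hv) v hv rfl, ?_⟩
  intro u hu v hv huv
  have : q u = q v := hf (by simpa using ⟨u, hu, rfl⟩) (by simpa using ⟨v, hv, rfl⟩) huv
  exact ⟨hq u hu v hv this, by simp [this]⟩

theorem weight_eq_sum_sign (L : V → Finset (α × Bool)) (s : Finset V) (c : α) :
    weight L s c = ∑ ε : Bool, (s.filter fun v => (c, ε) ∈ L v).card := by
  have h1 : ∀ v, ((L v).filter fun χ => χ.1 = c).card =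
      ∑ ε : Bool, if (c, ε) ∈ L v then 1 else 0 := by
    intro v
    have : ((L v).filter fun χ => χ.1 = c) =
        (Finset.univ.filter fun ε : Bool => (c, ε) ∈ L v).image fun ε => (c, ε) := by
      ext ⟨d, ε⟩
      simp only [Finset.mem_filter, Finset.mem_image, Finset.mem_univ, true_and, Prod.mk.injEq]
      constructor
      · rintro ⟨h, rfl⟩
        exact ⟨ε, h, rfl, rfl⟩
      · rintro ⟨ε', h, rfl, rfl⟩
        exact ⟨h, rfl⟩
    rw [this, Finset.card_image_of_injective _ (fun a b hab => (Prod.mk.inj hab).2),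
      Finset.card_filter]
  simp only [weight, h1]
  rw [Finset.sum_comm]
  simp only [Finset.card_filter]

/-- For each sign, the classes in `U` provide distinct vertices whose lists lack `c` with that sign.
-/
theorem weight_add_le {L : V → Finset (α × Bool)} {s : Finset V} (q : V → κ) {c : α}
    {U : Finset κ} (hc : ∀ l ∈ U, ∀ ε : Bool, ∃ v ∈ s, q v = l ∧ (c, ε) ∉ L v) :
    weight L s c + 2 * U.card ≤ 2 * s.card := by
  have hw : ∀ ε : Bool, (s.filter fun v => (c, ε) ∈ L v).card + U.card ≤ s.card := by
    intro ε
    have h1 : U.card ≤ (s.filter fun v => (c, ε) ∉ L v).card := by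
      refine (Finset.card_le_card (t := (s.filter fun v => (c, ε) ∉ L v).image q) ?_).trans
        Finset.card_image_le
      intro l hl
      obtain ⟨v, hv, hvl, hcv⟩ := hc l hl ε
      exact Finset.mem_image.2 ⟨v, by simp [hv, hcv], hvl⟩
    have h2 := Finset.card_filter_add_card_filter_not (s := s) (fun v => (c, ε) ∈ L v)
    omega
  rw [weight_eq_sum_sign, Fintype.sum_bool]
  have h1 := hw true
  have h2 := hw false
  omega

namespace MinimalCounterexample

variable {part : V → ι} {L : V → Finset (α × Bool)} {s : Finset V} {k : ℕ}

theorem weight_add_card_partsOfCard_le (h : MinimalCounterexample part L s k) (c : α) :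
    weight L s c + 2 * (partsOfCard part s 2).card ≤ 2 * s.card := by
  refine weight_add_le part ?_
  intro i hi ε
  obtain ⟨v, hv, hcv⟩ := h.not_forall_fiber_mem ((mem_partsOfCard (by norm_num)).1 hi) (c, ε)
  exact ⟨v, (mem_fiber.1 hv).1, (mem_fiber.1 hv).2, hcv⟩

/-- A set of classes that contains a singleton class and violates Hall's condition sees all
frequent colors. -/
theorem frequent_subset_of_violator (h : MinimalCounterexample part L s k) {q : V → κ}
    {U : Finset κ} (hU : U ⊆ s.image q) (hlt : (U.biUnion (classColors L s q)).card < U.card)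
    {v₀ : V} (hv₀ : v₀ ∈ s) (hqv₀ : q v₀ ∈ U) (hsing : ∀ v ∈ s, q v = q v₀ → v = v₀) :
    frequent L s k ⊆ U.biUnion (classColors L s q) := by
  have h1 : absList L v₀ ⊆ U.biUnion (classColors L s q) := by
    intro c hc
    obtain ⟨ε, hε⟩ := mem_absList.1 hc
    refine Finset.mem_biUnion.2 ⟨q v₀, hqv₀, (mem_classColors (hU hqv₀)).2 ⟨ε, ?_⟩⟩
    intro v hv hvq
    rwa [hsing v hv hvq]
  have h2 := Finset.card_le_card h1
  have h3 := h.le_card_absList hv₀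
  have h4 := h.card_le
  intro c hc
  by_contra hcU
  -- Since |U| > k, an unseen value has weight at most 2(2k + 1) - 2(k + 1) = 2k.
  have h5 := weight_add_le (L := L) (s := s) q (c := c) (by
    intro l hl ε
    by_contra! hcon
    exact hcU (Finset.mem_biUnion.2 ⟨l, hl, (mem_classColors (hU hl)).2 ⟨ε, hcon⟩⟩))
  have h6 := (Finset.mem_filter.1 hc).2
  omega

/-- There is no map to absolute values each class of which either has a common color, or is a
singleton colored by a frequent color. -/
theorem false_of_near_acceptable [Nonempty α] (h : MinimalCounterexample part L s k) (f : V → α)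
    (hpart : ∀ u ∈ s, ∀ v ∈ s, f u = f v → part u = part v)
    (hf : ∀ v ∈ s, (∃ ε, ∀ u ∈ s, f u = f v → (f v, ε) ∈ L u) ∨
      (f v ∈ frequent L s k ∧ ∀ u ∈ s, f u = f v → u = v)) : False := by
  refine h.not_colorable (colorable_of_hall_classes f hpart ?_)
  intro U hU
  by_contra! hlt
  -- The labels are themselves values, so some label in `U` is not seen by `U`. Its class has no
  -- common color with that value, hence is a singleton with a frequent label, and such a label is
  -- seen after all.
  obtain ⟨c, hc, hcU⟩ := Finset.exists_mem_notMem_of_card_lt_card hlt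
  obtain ⟨v, hv, rfl⟩ := Finset.mem_image.1 (hU hc)
  rcases hf v hv with hacc | ⟨hfr, hsing⟩
  · exact hcU (Finset.mem_biUnion.2 ⟨f v, hc, (mem_classColors (hU hc)).2 hacc⟩)
  · exact hcU (h.frequent_subset_of_violator hU hlt hv hc hsing hfr)

theorem pos (h : MinimalCounterexample part L s k) [Nonempty α] : 0 < k := by
  obtain ⟨v, hv⟩ := h.nonempty
  have := Finset.card_pos.2 ⟨part v, Finset.mem_image_of_mem part hv⟩
  have := h.card_parts
  omega

/-- Otherwise `s` has at most `k` vertices, but a single list already contains `k` values. -/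
theorem partsOfCard_two_nonempty [Nonempty α] (h : MinimalCounterexample part L s k) :
    (partsOfCard part s 2).Nonempty := by
  by_contra hne
  rw [Finset.not_nonempty_iff_eq_empty] at hne
  have hcard : ∀ i ∈ s.image part, (fiber part s i).card ≤ 1 := by
    intro i _
    by_contra! hcon
    have : i ∈ partsOfCard part s 2 := (mem_partsOfCard (by norm_num)).2 hcon
    simp [hne] at this
  have hn := Finset.sum_le_card_nsmul _ _ _ hcard
  rw [← card_eq_sum_fiber, smul_eq_mul, mul_one] at hn
  obtain ⟨v, hv⟩ := h.nonempty
  have h1 := h.le_card_absList hv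
  have h2 := Finset.card_le_card (absList_subset_palette (L := L) hv)
  have h3 := h.card_palette_lt
  have h4 := h.card_parts
  omega

/-- There are at least as many frequent colors as there are vertices in excess of the colors. -/
theorem card_le_card_palette_add_card_frequent [Nonempty α]
    (h : MinimalCounterexample part L s k) :
    s.card ≤ (palette L s).card + (frequent L s k).card := by
  have hsum : ∑ c ∈ palette L s, weight L s c = ∑ v ∈ s, (L v).card := by
    simp only [weight]
    rw [Finset.sum_comm]
    refine Finset.sum_congr rfl fun v hv => ?_
    exact (Finset.card_eq_sum_card_fiberwise fun χ hχ =>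
      absList_subset_palette hv (mem_absList_of_mem hχ)).symm
  have h1 : s.card * (2 * k) ≤ ∑ v ∈ s, (L v).card :=
    Finset.card_nsmul_le_sum _ _ _ h.card_list
  have h2 := Finset.sum_filter_add_sum_filter_not (palette L s) (fun c => 2 * k < weight L s c)
    (weight L s)
  have h3 : ∑ c ∈ frequent L s k, weight L s c ≤
      (frequent L s k).card * (2 * s.card - 2 * (partsOfCard part s 2).card) := by
    refine Finset.sum_le_card_nsmul _ _ _ fun c _ => ?_
    have := h.weight_add_card_partsOfCard_le c
    omega
  have h4 : ∑ c ∈ (palette L s).filter (fun c => ¬ 2 * k < weight L s c), weight L s c ≤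
      ((palette L s).filter (fun c => ¬ 2 * k < weight L s c)).card * (2 * k) := by
    refine Finset.sum_le_card_nsmul _ _ _ fun c hc => ?_
    simpa using (Finset.mem_filter.1 hc).2
  have h5 := Finset.card_filter_add_card_filter_not (s := palette L s)
    (fun c => 2 * k < weight L s c)
  change (frequent L s k).card + _ = _ at h5
  change ∑ c ∈ frequent L s k, weight L s c + _ = _ at h2
  have h6 := Finset.card_pos.2 h.partsOfCard_two_nonempty
  have h7 := h.card_le
  have h8 := h.pos
  -- Some part has two vertices, so a frequent value has weight at most 2(|s| - 1) ≤ 4k, twice the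
  -- bound for an infrequent one.
  have h9 : (frequent L s k).card * (2 * s.card - 2 * (partsOfCard part s 2).card) ≤
      (frequent L s k).card * (4 * k) := Nat.mul_le_mul_left _ (by omega)
  generalize ((palette L s).filter (fun c => ¬ 2 * k < weight L s c)).card = y at *
  have : s.card * (2 * k) ≤ ((frequent L s k).card * 2 + y) * (2 * k) := by linarith
  have := Nat.le_of_mul_le_mul_right this (by omega)
  omega

end MinimalCounterexample

end PartiteColoring

/-! ### Exchanging values and coloring large parts -/

namespace PartiteColoring

variable {V ι α : Type*} [DecidableEq V] [DecidableEq ι] [DecidableEq α]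

/-- The absolute values of the colors common to the lists of `a` and `b`. -/
def common (L : V → Finset (α × Bool)) (a b : V) : Finset α :=
  (L a ∩ L b).image Prod.fst

theorem mem_common {L : V → Finset (α × Bool)} {a b : V} {c : α} :
    c ∈ common L a b ↔ ∃ ε, (c, ε) ∈ L a ∧ (c, ε) ∈ L b := by
  simp [common]

/-- If the colors in `D` are used by vertices that have many alternatives outside `D`, then the
elements of `J` can be given distinct colors, after recoloring some of these vertices. -/
theorem exists_swap [Nonempty α] (D : Finset α) (J : Finset ι) (A : α → Finset α)
    (W : ι → Finset α) (hdA : ∀ d ∈ D, d ∈ A d) (hA : ∀ d ∈ D, J.card ≤ (A d \ D).card)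
    (hW : ∀ i ∈ J, J.card ≤ (W i).card) :
    ∃ (w : ι → α) (σ : α → α) (O : Finset α), O.card ≤ J.card ∧ Set.InjOn w J ∧
      (∀ i ∈ J, w i ∈ W i ∧ w i ∈ D ∪ O) ∧ Set.InjOn σ D ∧
      ∀ d ∈ D, σ d ∈ A d ∧ σ d ∈ D ∪ O ∧ ∀ i ∈ J, σ d ≠ w i := by
  classical
  obtain ⟨w, hw, hwW⟩ := J.exists_injOn_of_card_le W hW
  -- If `w i` lies in `D`, its previous user moves to a value `o i` outside `D`; if not, `o i = w i`
  -- is itself the new value. Either way one new value per element of `J` suffices.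
  obtain ⟨o, ho, hoT⟩ := J.exists_injOn_of_hall
    (fun i => if w i ∈ D then A (w i) \ D else {w i}) (by
      intro U hU
      by_cases hD : ∃ i ∈ U, w i ∈ D
      · obtain ⟨i, hi, hiD⟩ := hD
        have h1 := Finset.card_le_card (Finset.subset_biUnion_of_mem
          (fun i => if w i ∈ D then A (w i) \ D else {w i}) hi)
        simp only [hiD, if_true] at h1
        exact (Finset.card_le_card hU).trans ((hA _ hiD).trans h1)
      · push Not at hD
        rw [← Finset.card_image_of_injOn (hw.mono (Finset.coe_subset.2 hU))]
        refine Finset.card_le_card fun c hc => ?_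
        obtain ⟨i, hi, rfl⟩ := Finset.mem_image.1 hc
        exact Finset.mem_biUnion.2 ⟨i, hi, by simp [hD i hi]⟩)
  have hoD : ∀ i ∈ J, o i ∉ D := by
    intro i hi
    have := hoT i hi
    by_cases hiD : w i ∈ D
    · simp only [hiD, if_true, Finset.mem_sdiff] at this
      exact this.2
    · simp only [hiD, if_false, Finset.mem_singleton] at this
      rwa [this]
  have how : ∀ i ∈ J, w i ∉ D → o i = w i := by
    intro i hi hiD
    simpa [hiD] using hoT i hi
  have hex : ∀ d, ∃ c, (∀ i ∈ J, w i = d → c = o i) ∧ ((∀ i ∈ J, w i ≠ d) → c = d) := by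
    intro d
    by_cases hd : ∃ i ∈ J, w i = d
    · obtain ⟨i, hi, rfl⟩ := hd
      exact ⟨o i, fun j hj hji => by rw [hw hj hi hji], fun hcon => absurd rfl (hcon i hi)⟩
    · push Not at hd
      exact ⟨d, fun i hi hid => absurd hid (hd i hi), fun _ => rfl⟩
  choose σ hσ1 hσ2 using hex
  refine ⟨w, σ, J.image o, Finset.card_image_le, hw, fun i hi => ⟨hwW i hi, ?_⟩, ?_, ?_⟩
  · by_cases hiD : w i ∈ D
    · exact Finset.mem_union_left _ hiD
    · exact Finset.mem_union_right _ (Finset.mem_image.2 ⟨i, hi, how i hi hiD⟩)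
  · intro d hd d' hd' hdd
    rw [Finset.mem_coe] at hd hd'
    by_cases h1 : ∃ i ∈ J, w i = d <;> by_cases h2 : ∃ i ∈ J, w i = d'
    · obtain ⟨i, hi, rfl⟩ := h1
      obtain ⟨j, hj, rfl⟩ := h2
      rw [hσ1 _ i hi rfl, hσ1 _ j hj rfl] at hdd
      rw [ho hi hj hdd]
    · obtain ⟨i, hi, rfl⟩ := h1
      push Not at h2
      rw [hσ1 _ i hi rfl, hσ2 _ h2] at hdd
      exact absurd (hdd ▸ hd') (hoD i hi)
    · obtain ⟨i, hi, rfl⟩ := h2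
      push Not at h1
      rw [hσ1 _ i hi rfl, hσ2 _ h1] at hdd
      exact absurd (hdd ▸ hd) (hoD i hi)
    · push Not at h1 h2
      rwa [hσ2 _ h1, hσ2 _ h2] at hdd
  · intro d hd
    by_cases h1 : ∃ i ∈ J, w i = d
    · obtain ⟨i, hi, rfl⟩ := h1
      rw [hσ1 _ i hi rfl]
      refine ⟨?_, Finset.mem_union_right _ (Finset.mem_image_of_mem o hi), ?_⟩
      · have := hoT i hi
        simp only [hd, if_true, Finset.mem_sdiff] at this
        exact this.1
      · intro j hj hij
        have hjD : w j ∉ D := hij ▸ hoD i hi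
        rw [← how j hj hjD] at hij
        rw [ho hi hj hij] at hd
        exact hjD hd
    · push Not at h1
      rw [hσ2 _ h1]
      exact ⟨hdA d hd, Finset.mem_union_left _ hd, fun i hi hdi => h1 i hi hdi.symm⟩

theorem IsPartialColoring.update {part : V → ι} {L : V → Finset (α × Bool)} {X : Finset V}
    {f : V → α × Bool} {y : V} (hf : IsPartialColoring part L (X.erase y) f) {χ : α × Bool}
    (hχ : χ ∈ L y) (hcompat : ∀ v ∈ X.erase y, (f v).1 = χ.1 → part v = part y ∧ f v = χ) :
    IsPartialColoring part L X (Function.update f y χ) := by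
  constructor
  · intro v hv
    by_cases hvy : v = y
    · subst hvy
      simpa using hχ
    · simpa [hvy] using hf.1 v (Finset.mem_erase.2 ⟨hvy, hv⟩)
  · intro u hu v hv huv
    by_cases huy : u = y <;> by_cases hvy : v = y
    · subst huy
      subst hvy
      simp
    · subst huy
      simp only [Function.update_self, Function.update_of_ne hvy] at huv ⊢
      have := hcompat v (Finset.mem_erase.2 ⟨hvy, hv⟩) huv.symm
      exact ⟨this.1.symm, this.2.symm⟩
    · subst hvy
      simp only [Function.update_self, Function.update_of_ne huy] at huv ⊢
      exact hcompat u (Finset.mem_erase.2 ⟨huy, hu⟩) huv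
    · simp only [Function.update_of_ne huy, Function.update_of_ne hvy] at huv ⊢
      exact hf.2 u (Finset.mem_erase.2 ⟨huy, hu⟩) v (Finset.mem_erase.2 ⟨hvy, hv⟩) huv

theorem card_biUnion_fiber (part : V → ι) (s : Finset V) (J : Finset ι) :
    (J.biUnion (fiber part s)).card = ∑ i ∈ J, (fiber part s i).card := by
  refine Finset.card_biUnion fun i _ j _ hij => ?_
  rw [Function.onFun, Finset.disjoint_left]
  intro v hvi hvj
  exact hij ((mem_fiber.1 hvi).2.symm.trans (mem_fiber.1 hvj).2)

namespace MinimalCounterexample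

variable {part : V → ι} {L : V → Finset (α × Bool)} {s : Finset V} {k : ℕ}

/-- There are at most 2|C| colors, so the two lists share at least 4k - 2|C| of them, and at most
two of these have the same value. -/
theorem le_card_palette_add_card_common (h : MinimalCounterexample part L s k) {a b : V}
    (ha : a ∈ s) (hb : b ∈ s) : 2 * k ≤ (palette L s).card + (common L a b).card := by
  have h1 := h.card_list a ha
  have h2 := h.card_list b hb
  have h3 := Finset.card_union_add_card_inter (L a) (L b)
  have h4 := card_le_of_fst_mem (M := L a ∪ L b) (D := palette L s) (by
    intro χ hχ
    rcases Finset.mem_union.1 hχ with hχ | hχ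
    · exact absList_subset_palette ha (mem_absList_of_mem hχ)
    · exact absList_subset_palette hb (mem_absList_of_mem hχ))
  have h5 := card_le_of_fst_mem (M := L a ∩ L b) (D := common L a b)
    (fun χ hχ => Finset.mem_image_of_mem _ hχ)
  omega

/-- The parts of `J` are colored together with other vertices using colors from `D` and at most
`|J|` further ones, where the remaining vertices do not have colors in `D`. -/
theorem false_of_coloring_parts [Nonempty α] (h : MinimalCounterexample part L s k) {X : Finset V}
    (hXs : X ⊆ s) {J : Finset ι} (hJ : J.Nonempty) (hJs : J ⊆ partsOfCard part s 3)
    (hJX : ∀ i ∈ J, fiber part s i ⊆ X) {f : V → α × Bool} (hf : IsPartialColoring part L X f)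
    (D O : Finset α) (hDO : ∀ v ∈ X, (f v).1 ∈ D ∪ O) (hD : ∀ v ∈ s \ X, ∀ χ ∈ L v, χ.1 ∉ D)
    (hO : O.card ≤ J.card) : False := by
  have h1 : 3 * J.card ≤ (J.biUnion (fiber part s)).card := by
    rw [card_biUnion_fiber, mul_comm]
    exact Finset.card_nsmul_le_sum _ _ _ fun i hi => (mem_partsOfCard (by norm_num)).1 (hJs hi)
  have h2 := Finset.card_le_card (Finset.biUnion_subset.2 hJX)
  have h3 := Finset.card_sdiff_add_card_eq_card hXs
  have h4 := h.card_le
  have h5 : J ⊆ s.image part := hJs.trans (Finset.filter_subset _ _)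
  have h6 : (s \ X).image part ⊆ s.image part \ J := by
    intro i hi
    obtain ⟨v, hv, rfl⟩ := Finset.mem_image.1 hi
    rw [Finset.mem_sdiff] at hv ⊢
    exact ⟨Finset.mem_image_of_mem _ hv.1, fun hvJ =>
      hv.2 (hJX _ hvJ (mem_fiber.2 ⟨hv.1, rfl⟩))⟩
  have h7 := Finset.card_le_card h6
  have h8 := Finset.card_sdiff_add_card_eq_card h5
  have h9 := h.card_parts
  have h10 := Finset.card_pos.2 hJ
  refine h.false_of_extension hXs ?_ hf D O J.card hDO hD hO (by omega) (by omega)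
  rw [← Finset.card_pos]
  omega

end MinimalCounterexample

end PartiteColoring

/-! ### Hall's condition for infrequent values and doubled parts -/

namespace PartiteColoring

variable {V ι α : Type*} [DecidableEq V] [DecidableEq ι] [DecidableEq α]

namespace MinimalCounterexample

variable {part : V → ι} {L : V → Finset (α × Bool)} {s : Finset V} {k : ℕ}

/-- There is no set `X` of vertices containing the parts of `J`, whose vertices are labelled
injectively by the colors of `D`, except for at most two vertices in each part of `J` and at most
one in the part `Q₀`, where the colors of `D` do not occur outside of `X`. -/
theorem false_of_labelling [Nonempty α] (h : MinimalCounterexample part L s k) {X : Finset V}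
    (hXs : X ⊆ s) {J : Finset ι} (hJs : J ⊆ partsOfCard part s 3)
    (hJX : ∀ i ∈ J, fiber part s i ⊆ X) {Q₀ : ι} (hQ₀ : Q₀ ∈ J) {D : Finset α}
    (g : V → α ⊕ ι) (hinl : ∀ v ∈ X, ∀ d, g v = Sum.inl d → d ∈ D ∧ d ∈ absList L v)
    (hinr : ∀ v ∈ X, ∀ i, g v = Sum.inr i → i ∈ J ∧ part v = i)
    (hinj : ∀ u ∈ X, ∀ v ∈ X, ∀ d, g u = Sum.inl d → g v = Sum.inl d → u = v)
    (hpair : ∀ i ∈ J.erase Q₀, ∃ a ∈ s, ∃ b ∈ s, ∀ v ∈ X, g v = Sum.inr i → v = a ∨ v = b)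
    (hone : ∀ u ∈ X, ∀ v ∈ X, g u = Sum.inr Q₀ → g v = Sum.inr Q₀ → u = v)
    (hsurj : ∀ d ∈ D, ∃ v ∈ X, g v = Sum.inl d)
    (hDk : D.card + k ≤ (palette L s).card) (hJcard : J.card + (palette L s).card ≤ s.card)
    (hD : ∀ v ∈ s \ X, ∀ χ ∈ L v, χ.1 ∉ D) : False := by
  obtain ⟨v₀, -⟩ := h.nonempty
  have : Nonempty V := ⟨v₀⟩
  choose! a ha b hb hab using hpair
  choose! m hmX hm using hsurj
  have hJ' := Finset.card_erase_of_mem hQ₀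
  have hJpos := Finset.card_pos.2 ⟨Q₀, hQ₀⟩
  have hn := h.card_le
  -- Leaving out `Q₀` saves one new value for its only unlabelled vertex.
  obtain ⟨w, σ, O, hO, hw, hwW, hσ, hσA⟩ := exists_swap D (J.erase Q₀)
    (fun d => absList L (m d)) (fun i => common L (a i) (b i))
    (fun d hd => (hinl _ (hmX d hd) d (hm d hd)).2) (by
      intro d hd
      have h1 := h.le_card_absList (hXs (hmX d hd))
      have h2 := Finset.le_card_sdiff D (absList L (m d))
      omega) (by
      intro i hi
      have h1 := h.le_card_palette_add_card_common (ha i hi) (hb i hi)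
      omega)
  have he : ∀ d ∈ D, ∃ ε, (σ d, ε) ∈ L (m d) := fun d hd => mem_absList.1 (hσA d hd).1
  have he' : ∀ i ∈ J.erase Q₀, ∃ ε, (w i, ε) ∈ L (a i) ∧ (w i, ε) ∈ L (b i) := fun i hi =>
    mem_common.1 (hwW i hi).1
  choose! e he using he
  choose! e' he' using he'
  let φ : V → α × Bool := fun v => Sum.elim (fun d => (σ d, e d)) (fun i => (w i, e' i)) (g v)
  have hφl : ∀ v d, g v = Sum.inl d → φ v = (σ d, e d) := fun v d hv => by simp [φ, hv]
  have hφr : ∀ v i, g v = Sum.inr i → φ v = (w i, e' i) := fun v i hv => by simp [φ, hv]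
  have hφ : IsPartialColoring part L (X.filter fun v => g v ≠ Sum.inr Q₀) φ := by
    constructor
    · intro v hv
      rw [Finset.mem_filter] at hv
      rcases hgv : g v with d | i
      · rw [hφl v d hgv]
        have hd := (hinl v hv.1 d hgv).1
        have := he d hd
        rwa [hinj _ (hmX d hd) v hv.1 d (hm d hd) hgv] at this
      · rw [hφr v i hgv]
        have hi : i ∈ J.erase Q₀ := Finset.mem_erase.2
          ⟨fun hi => hv.2 (by rw [hgv, hi]), (hinr v hv.1 i hgv).1⟩
        rcases hab i hi v hv.1 hgv with rfl | rfl
        · exact (he' i hi).1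
        · exact (he' i hi).2
    · intro u hu v hv huv
      rw [Finset.mem_filter] at hu hv
      rcases hgu : g u with d | i <;> rcases hgv : g v with d' | i'
      · rw [hφl u d hgu, hφl v d' hgv] at huv
        have hdd : d = d' := hσ (hinl u hu.1 d hgu).1 (hinl v hv.1 d' hgv).1 huv
        subst hdd
        rw [hinj u hu.1 v hv.1 d hgu hgv]
        simp
      · rw [hφl u d hgu, hφr v i' hgv] at huv
        refine absurd huv ((hσA d (hinl u hu.1 d hgu).1).2.2 i' (Finset.mem_erase.2
          ⟨fun hi => hv.2 (by rw [hgv, hi]), (hinr v hv.1 i' hgv).1⟩))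
      · rw [hφr u i hgu, hφl v d' hgv] at huv
        refine absurd huv.symm ((hσA d' (hinl v hv.1 d' hgv).1).2.2 i (Finset.mem_erase.2
          ⟨fun hi => hu.2 (by rw [hgu, hi]), (hinr u hu.1 i hgu).1⟩))
      · rw [hφr u i hgu, hφr v i' hgv] at huv
        have hii : i = i' := hw (Finset.mem_coe.2 (Finset.mem_erase.2
          ⟨fun hi => hu.2 (by rw [hgu, hi]), (hinr u hu.1 i hgu).1⟩))
          (Finset.mem_coe.2 (Finset.mem_erase.2
          ⟨fun hi => hv.2 (by rw [hgv, hi]), (hinr v hv.1 i' hgv).1⟩)) huv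
        subst hii
        rw [hφr u i hgu, hφr v i hgv, (hinr u hu.1 i hgu).2, (hinr v hv.1 i hgv).2]
        simp
  have hφDO : ∀ v ∈ X, g v ≠ Sum.inr Q₀ → (φ v).1 ∈ D ∪ O := by
    intro v hv hvQ
    rcases hgv : g v with d | i
    · rw [hφl v d hgv]
      exact (hσA d (hinl v hv d hgv).1).2.1
    · rw [hφr v i hgv]
      exact (hwW i (Finset.mem_erase.2
          ⟨fun hi => hvQ (by rw [hgv, hi]), (hinr v hv i hgv).1⟩)).2
  by_cases hy : ∃ y ∈ X, g y = Sum.inr Q₀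
  · obtain ⟨y, hyX, hy⟩ := hy
    have herase : (X.filter fun v => g v ≠ Sum.inr Q₀) = X.erase y := by
      ext v
      simp only [Finset.mem_filter, Finset.mem_erase]
      constructor
      · rintro ⟨hv, hvQ⟩
        exact ⟨fun hvy => hvQ (by rw [hvy, hy]), hv⟩
      · rintro ⟨hvy, hv⟩
        exact ⟨hv, fun hvQ => hvy (hone v hv y hyX hvQ hy)⟩
    rw [herase] at hφ
    have hφDO' : ∀ v ∈ X.erase y, (φ v).1 ∈ D ∪ O := by
      intro v hv
      rw [← herase, Finset.mem_filter] at hv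
      exact hφDO v hv.1 hv.2
    by_cases hex : ∃ χ ∈ L y, χ.1 ∉ D ∪ O
    · obtain ⟨χ, hχ, hχO⟩ := hex
      refine h.false_of_coloring_parts hXs ⟨Q₀, hQ₀⟩ hJs hJX (hφ.update hχ ?_) D (insert χ.1 O)
        ?_ hD ?_
      · intro v hv hvχ
        exact absurd (hvχ ▸ hφDO' v hv) hχO
      · intro v hv
        by_cases hvy : v = y
        · simp [hvy]
        · have := hφDO' v (Finset.mem_erase.2 ⟨hvy, hv⟩)
          rw [Function.update_of_ne hvy]
          simp only [Finset.mem_union, Finset.mem_insert] at this ⊢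
          tauto
      · have := Finset.card_insert_le χ.1 O
        omega
    -- Here |D ∪ O| ≤ k, so the list of `y` consists of all colors with values in `D ∪ O`. Hence `y`
    -- can copy the color of another vertex of its part.
    · push Not at hex
      have h1 := h.card_list y (hXs hyX)
      have h2 : L y ⊆ (D ∪ O) ×ˢ (Finset.univ : Finset Bool) := fun χ hχ => by
        simpa using hex χ hχ
      have h3 := Finset.card_union_le D O
      have h4 : L y = (D ∪ O) ×ˢ (Finset.univ : Finset Bool) := by
        refine Finset.eq_of_subset_of_card_le h2 ?_
        rw [Finset.card_product, Finset.card_univ, Fintype.card_bool]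
        omega
      obtain ⟨x, hx, hxy⟩ : ∃ x ∈ fiber part s Q₀, x ≠ y := by
        by_contra! hcon
        have h5 := Finset.card_le_card (fun x hx => Finset.mem_singleton.2 (hcon x hx) :
          fiber part s Q₀ ⊆ {y})
        have h6 := (mem_partsOfCard (by norm_num)).1 (hJs hQ₀)
        simp only [Finset.card_singleton] at h5
        omega
      have hxX : x ∈ X.erase y := Finset.mem_erase.2 ⟨hxy, hJX Q₀ hQ₀ hx⟩
      have hxL : φ x ∈ L y := by
        rw [h4]
        simpa using hφDO' x hxX
      refine h.false_of_coloring_parts hXs ⟨Q₀, hQ₀⟩ hJs hJX (hφ.update hxL ?_) D O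
        ?_ hD (by omega)
      · intro v hv hvx
        have := hφ.2 v hv x hxX hvx
        rw [this.1, this.2, (mem_fiber.1 hx).2, (hinr y hyX _ hy).2]
        simp
      · intro v hv
        by_cases hvy : v = y
        · simpa [hvy] using hφDO' x hxX
        · rw [Function.update_of_ne hvy]
          exact hφDO' v (Finset.mem_erase.2 ⟨hvy, hv⟩)
  · push Not at hy
    rw [Finset.filter_true_of_mem hy] at hφ
    exact h.false_of_coloring_parts hXs ⟨Q₀, hQ₀⟩ hJs hJX hφ D O
      (fun v hv => hφDO v hv (hy v hv)) hD (by omega)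

/-- The system consisting of the infrequent colors, with their holders, and of two copies of each
part in `Qs` has a system of distinct representatives. -/
theorem hall_infrequent_and_parts [Nonempty α] (h : MinimalCounterexample part L s k)
    {Qs : Finset ι} (hQs : Qs ⊆ partsOfCard part s 3)
    (hcard : Qs.card + (palette L s).card = s.card) :
    ∀ u ⊆ (palette L s \ frequent L s k).disjSum (Qs ×ˢ (Finset.univ : Finset Bool)),
      u.card ≤ (u.biUnion
        (Sum.elim (holders L s) fun p : ι × Bool => fiber part s p.1)).card := by
  obtain ⟨v₀, -⟩ := h.nonempty
  have : Nonempty V := ⟨v₀⟩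
  by_contra! hcon
  obtain ⟨u, hus, -, hucard, hu⟩ := Finset.exists_minimal_hall_violator _ _ hcon
  set t : α ⊕ ι × Bool → Finset V :=
    Sum.elim (holders L s) fun p : ι × Bool => fiber part s p.1 with ht
  set D : Finset α := (palette L s \ frequent L s k).filter fun c => Sum.inl c ∈ u with hDdef
  set J : Finset ι := Qs.filter fun i => ∃ β, Sum.inr (i, β) ∈ u with hJdef
  have hmemD : ∀ c, Sum.inl c ∈ u ↔ c ∈ D := by
    intro c
    rw [hDdef, Finset.mem_filter]
    refine ⟨fun hc => ⟨?_, hc⟩, fun hc => hc.2⟩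
    simpa only [Finset.inl_mem_disjSum] using hus hc
  have hmemJ : ∀ i β, Sum.inr (i, β) ∈ u → i ∈ J := by
    intro i β hi
    rw [hJdef, Finset.mem_filter]
    refine ⟨?_, β, hi⟩
    have := hus hi
    simp only [Finset.inr_mem_disjSum, Finset.mem_product] at this
    exact this.1
  have hDsub : D ⊆ palette L s \ frequent L s k := Finset.filter_subset _ _
  have hJsub : J ⊆ Qs := Finset.filter_subset _ _
  have husub : u ⊆ D.disjSum (J ×ˢ (Finset.univ : Finset Bool)) := by
    rintro (c | ⟨i, β⟩) hc
    · simpa using (hmemD c).1 hc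
    · simpa using hmemJ i β hc
  have hule := Finset.card_le_card husub
  rw [Finset.card_disjSum, Finset.card_product, Finset.card_univ, Fintype.card_bool] at hule
  have hXs : u.biUnion t ⊆ s := by
    refine Finset.biUnion_subset.2 ?_
    rintro (c | ⟨i, β⟩) -
    · exact Finset.filter_subset _ _
    · exact Finset.filter_subset _ _
  -- Otherwise `u` would be a Hall violator among the values alone.
  have hJne : J.Nonempty := by
    by_contra hne
    rw [Finset.not_nonempty_iff_eq_empty] at hne
    have h1 := h.card_le_card_biUnion_holders (hDsub.trans Finset.sdiff_subset)
    have h2 : D.biUnion (holders L s) ⊆ u.biUnion t := by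
      refine Finset.biUnion_subset.2 fun c hc => ?_
      exact Finset.subset_biUnion_of_mem t ((hmemD c).2 hc)
    have h3 := Finset.card_le_card h2
    rw [hne, Finset.card_empty] at hule
    omega
  obtain ⟨Q₀, hQ₀⟩ := hJne
  obtain ⟨β₀, hβ₀⟩ := (Finset.mem_filter.1 hQ₀).2
  -- With one copy of `Q₀` discarded, the rest of `u` is matched onto the whole neighbourhood, and
  -- at most one vertex is matched to `Q₀`.
  obtain ⟨f, hf, hft, himg⟩ := hu _ hβ₀
  have hpre : ∀ v ∈ u.biUnion t, ∃ l ∈ u.erase (Sum.inr (Q₀, β₀)), f l = v := by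
    intro v hv
    rw [← himg] at hv
    exact Finset.mem_image.1 hv
  have : Nonempty (α ⊕ ι × Bool) := ⟨Sum.inr (Q₀, β₀)⟩
  choose! p hp hfp using hpre
  have hD : ∀ v ∈ s \ u.biUnion t, ∀ χ ∈ L v, χ.1 ∉ D := by
    intro v hv χ hχ hχD
    rw [Finset.mem_sdiff] at hv
    exact hv.2 (Finset.mem_biUnion.2 ⟨Sum.inl χ.1, (hmemD _).2 hχD,
      mem_holders.2 ⟨hv.1, mem_absList_of_mem hχ⟩⟩)
  have hfr : frequent L s k ⊆ palette L s := Finset.filter_subset _ _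
  have h1 := h.card_le_card_palette_add_card_frequent
  have h2 := Finset.card_le_card hDsub
  rw [Finset.card_sdiff_of_subset hfr] at h2
  have h2' := Finset.card_le_card hfr
  have h3 := Finset.card_le_card hJsub
  -- The whole system has at most |s| members, since there are at least |s| - |C| frequent values.
  -- So the violator misses some vertex, whose list supplies `k` values outside `D`.
  obtain ⟨v, hv⟩ : (s \ u.biUnion t).Nonempty := by
    rw [← Finset.card_pos]
    have := Finset.card_sdiff_add_card_eq_card hXs
    omega
  have hDk : D.card + k ≤ (palette L s).card := by
    have h4 := h.le_card_absList (Finset.mem_sdiff.1 hv).1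
    have h5 : Disjoint D (absList L v) := by
      rw [Finset.disjoint_right]
      intro c hc
      obtain ⟨ε, hε⟩ := mem_absList.1 hc
      exact hD v hv _ hε
    have h6 := Finset.card_le_card (Finset.union_subset (hDsub.trans Finset.sdiff_subset)
      (absList_subset_palette (L := L) (Finset.mem_sdiff.1 hv).1))
    rw [Finset.card_union_of_disjoint h5] at h6
    omega
  have hfib : ∀ i β, Sum.inr (i, β) ∈ u.erase (Sum.inr (Q₀, β₀)) →
      f (Sum.inr (i, β)) ∈ fiber part s i := fun i β hi => hft _ hi
  let g : V → α ⊕ ι := fun v => Sum.map id Prod.fst (p v)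
  have hgl : ∀ v d, g v = Sum.inl d → p v = Sum.inl d := by
    intro v d hv
    rcases hpv : p v with c | q <;> simp [g, hpv] at hv
    rw [hv]
  have hgr : ∀ v i, g v = Sum.inr i → ∃ β, p v = Sum.inr (i, β) := by
    intro v i hv
    rcases hpv : p v with c | q <;> simp [g, hpv] at hv
    exact ⟨q.2, by rw [← hv]⟩
  refine h.false_of_labelling hXs (hJsub.trans hQs) ?_ hQ₀ (D := D) g ?_ ?_ ?_ ?_ ?_ ?_ hDk
    (by omega) hD
  · intro i hi
    obtain ⟨β, hβ⟩ := (Finset.mem_filter.1 hi).2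
    exact Finset.subset_biUnion_of_mem t hβ
  · intro v hv d hd
    have h4 := hp v hv
    have h5 := hfp v hv
    rw [hgl v d hd] at h4 h5
    refine ⟨(hmemD d).1 (Finset.mem_of_mem_erase h4), ?_⟩
    rw [← h5]
    exact (mem_holders.1 (hft _ h4)).2
  · intro v hv i hi
    obtain ⟨β, hβ⟩ := hgr v i hi
    have h4 := hp v hv
    have h5 := hfp v hv
    rw [hβ] at h4 h5
    refine ⟨hmemJ i β (Finset.mem_of_mem_erase h4), ?_⟩
    rw [← h5]
    exact (mem_fiber.1 (hfib _ _ h4)).2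
  · intro v hv w hw d hvd hwd
    rw [← hfp v hv, ← hfp w hw, hgl v d hvd, hgl w d hwd]
  · intro i hi
    have hiQ : i ≠ Q₀ := (Finset.mem_erase.1 hi).1
    have key : ∀ β, Sum.inr (i, β) ∈ u → f (Sum.inr (i, β)) ∈ s := by
      intro β hβ
      exact (mem_fiber.1 (hfib i β (Finset.mem_erase.2 ⟨by simp [hiQ], hβ⟩))).1
    have key2 : ∀ v ∈ u.biUnion t, g v = Sum.inr i →
        ∃ β, Sum.inr (i, β) ∈ u ∧ v = f (Sum.inr (i, β)) := by
      intro v hv hvi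
      obtain ⟨β, hβ⟩ := hgr v i hvi
      have h4 := hp v hv
      have h5 := hfp v hv
      rw [hβ] at h4 h5
      exact ⟨β, Finset.mem_of_mem_erase h4, h5.symm⟩
    obtain ⟨β, hβ⟩ := (Finset.mem_filter.1 (Finset.mem_of_mem_erase hi)).2
    by_cases hnb : Sum.inr (i, !β) ∈ u
    · refine ⟨_, key β hβ, _, key _ hnb, fun v hv hvi => ?_⟩
      obtain ⟨β', -, rfl⟩ := key2 v hv hvi
      by_cases hb : β' = β
      · left
        rw [hb]
      · right
        rw [Bool.eq_not.2 hb]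
    · refine ⟨_, key β hβ, _, key β hβ, fun v hv hvi => ?_⟩
      obtain ⟨β', hβ', rfl⟩ := key2 v hv hvi
      by_cases hb : β' = β
      · left
        rw [hb]
      · rw [Bool.eq_not.2 hb] at hβ'
        exact absurd hβ' hnb
  · have key : ∀ v ∈ u.biUnion t, g v = Sum.inr Q₀ → v = f (Sum.inr (Q₀, !β₀)) := by
      intro v hv hvi
      obtain ⟨β, hβ⟩ := hgr v _ hvi
      have h4 := hp v hv
      have h5 := hfp v hv
      rw [hβ] at h4 h5
      have hb : β ≠ β₀ := fun hb => (Finset.mem_erase.1 h4).1 (by rw [hb])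
      rw [← h5, Bool.eq_not.2 hb]
    intro v hv w hw hvi hwi
    rw [key v hv hvi, key w hw hwi]
  · intro d hd
    have hdu : Sum.inl d ∈ u.erase (Sum.inr (Q₀, β₀)) :=
      Finset.mem_erase.2 ⟨by simp, (hmemD d).2 hd⟩
    have hX : f (Sum.inl d) ∈ u.biUnion t := by
      rw [← himg]
      exact Finset.mem_image_of_mem f hdu
    refine ⟨_, hX, ?_⟩
    have : p (f (Sum.inl d)) = Sum.inl d :=
      hf (Finset.mem_coe.2 (hp _ hX)) (Finset.mem_coe.2 hdu) (hfp _ hX)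
    simp [g, this]

end MinimalCounterexample

end PartiteColoring

/-! ### Merging pairs in parts with at least three vertices -/

namespace PartiteColoring

variable {V ι α : Type*} [DecidableEq V] [DecidableEq ι] [DecidableEq α]

namespace MinimalCounterexample

variable {part : V → ι} {L : V → Finset (α × Bool)} {s : Finset V} {k : ℕ}

/-- One cannot pair up vertices in as many parts as there are vertices in excess of the colors, so
that the pairs can be colored with distinct colors, compatibly with a matching of the infrequent
colors to vertices. -/
theorem false_of_pairs [Nonempty α] (h : MinimalCounterexample part L s k) {Qs : Finset ι}
    (hcard : Qs.card + (palette L s).card = s.card) {M : α → V}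
    (hM : Set.InjOn M (palette L s \ frequent L s k : Finset α))
    (hMh : ∀ c ∈ palette L s \ frequent L s k, M c ∈ holders L s c) {a b : ι → V}
    (ha : ∀ i ∈ Qs, a i ∈ fiber part s i) (hb : ∀ i ∈ Qs, b i ∈ fiber part s i)
    (hab : ∀ i ∈ Qs, a i ≠ b i) {w : ι → α} (hw : Set.InjOn w Qs)
    (hwc : ∀ i ∈ Qs, w i ∈ common L (a i) (b i))
    (hMab : ∀ c ∈ palette L s \ frequent L s k, ∀ i ∈ Qs, M c = a i ∨ M c = b i → c = w i) :
    False := by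
  -- Each `b i` is merged with `a i`; every other vertex is a class by itself.
  let q : V → V := fun v => if part v ∈ Qs ∧ v = b (part v) then a (part v) else v
  have hpa : ∀ i ∈ Qs, part (a i) = i := fun i hi => (mem_fiber.1 (ha i hi)).2
  have hpb : ∀ i ∈ Qs, part (b i) = i := fun i hi => (mem_fiber.1 (hb i hi)).2
  have hqb : ∀ i ∈ Qs, q (b i) = a i := by
    intro i hi
    simp [q, hpb i hi, hi]
  have hqne : ∀ v, (∀ i ∈ Qs, v ≠ b i) → q v = v := by
    intro v hv
    simp only [q, ite_eq_right_iff, and_imp]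
    intro hvQ hvb
    exact absurd hvb (hv _ hvQ)
  have hqa : ∀ i ∈ Qs, q (a i) = a i := by
    intro i hi
    refine hqne _ fun j hj hij => hab i hi ?_
    have : i = j := by rw [← hpa i hi, hij, hpb j hj]
    rw [hij, this]
  have hqcases : ∀ v, (∃ i ∈ Qs, v = b i ∧ q v = a i) ∨ ((∀ i ∈ Qs, v ≠ b i) ∧ q v = v) := by
    intro v
    by_cases hv : ∃ i ∈ Qs, v = b i
    · obtain ⟨i, hi, rfl⟩ := hv
      exact Or.inl ⟨i, hi, rfl, hqb i hi⟩
    · push Not at hv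
      exact Or.inr ⟨hv, hqne v hv⟩
  have hqpart : ∀ v, part (q v) = part v := by
    intro v
    rcases hqcases v with ⟨i, hi, rfl, hq⟩ | ⟨-, hq⟩
    · rw [hq, hpa i hi, hpb i hi]
    · rw [hq]
  have hqpair : ∀ v, ∀ i ∈ Qs, q v = a i → v = a i ∨ v = b i := by
    intro v i hi hvi
    rcases hqcases v with ⟨j, hj, rfl, hq⟩ | ⟨-, hq⟩
    · right
      rw [hq] at hvi
      rw [← hpa i hi, ← hvi, hpa j hj]
    · left
      rw [← hq, hvi]
  have hqsing : ∀ l, (∀ i ∈ Qs, l ≠ a i) → ∀ v, q v = l → v = l := by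
    rintro l hl v rfl
    rcases hqcases v with ⟨i, hi, rfl, hq⟩ | ⟨-, hq⟩
    · exact absurd hq (hl i hi)
    · exact hq.symm
  have hbinj : Set.InjOn b Qs := by
    intro i hi j hj hij
    rw [← hpb i hi, hij, hpb j hj]
  have himg : s.image q = s \ Qs.image b := by
    ext l
    simp only [Finset.mem_image, Finset.mem_sdiff, not_exists, not_and]
    constructor
    · rintro ⟨v, hv, rfl⟩
      rcases hqcases v with ⟨i, hi, rfl, hq⟩ | ⟨hne, hq⟩
      · rw [hq]
        refine ⟨(mem_fiber.1 (ha i hi)).1, fun j hj hij => hab i hi ?_⟩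
        have : i = j := by rw [← hpa i hi, ← hij, hpb j hj]
        rw [← hij, this]
      · rw [hq]
        exact ⟨hv, fun i hi hiv => hne i hi hiv.symm⟩
    · rintro ⟨hl, hne⟩
      exact ⟨l, hl, hqne l fun i hi hil => hne i hi hil.symm⟩
  -- Merging |s| - |C| pairs leaves exactly as many classes as values.
  have himgcard : (s.image q).card = (palette L s).card := by
    have hsub : Qs.image b ⊆ s := fun v hv => by
      obtain ⟨i, hi, rfl⟩ := Finset.mem_image.1 hv
      exact (mem_fiber.1 (hb i hi)).1
    rw [himg, Finset.card_sdiff_of_subset hsub, Finset.card_image_of_injOn hbinj]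
    omega
  have hwclass : ∀ i ∈ Qs, w i ∈ classColors L s q (a i) := by
    intro i hi
    refine (mem_classColors (Finset.mem_image.2
      ⟨a i, (mem_fiber.1 (ha i hi)).1, hqa i hi⟩)).2 ?_
    obtain ⟨ε, h1, h2⟩ := mem_common.1 (hwc i hi)
    refine ⟨ε, fun v hv hvi => ?_⟩
    rcases hqpair v i hi hvi with rfl | rfl
    · exact h1
    · exact h2
  refine h.not_colorable (colorable_of_hall_classes q
    (fun u _ v _ huv => by rw [← hqpart u, huv, hqpart v]) fun U hU => ?_)
  by_cases hall : ∀ l ∈ U, ∃ i ∈ Qs, l = a i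
  · have hinj : Set.InjOn (fun l => w (part l)) U := by
      intro l hl l' hl' hll
      obtain ⟨i, hi, rfl⟩ := hall l hl
      obtain ⟨j, hj, rfl⟩ := hall l' hl'
      simp only [hpa i hi, hpa j hj] at hll
      rw [hw hi hj hll]
    rw [← Finset.card_image_of_injOn hinj]
    refine Finset.card_le_card fun c hc => ?_
    obtain ⟨l, hl, rfl⟩ := Finset.mem_image.1 hc
    obtain ⟨i, hi, rfl⟩ := hall l hl
    simp only [hpa i hi]
    exact Finset.mem_biUnion.2 ⟨a i, hl, hwclass i hi⟩
  · push Not at hall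
    obtain ⟨l, hl, hla⟩ := hall
    by_contra! hlt
    set T := U.biUnion (classColors L s q) with hT
    have hTC : T ⊆ palette L s := Finset.biUnion_subset.2 fun _ _ => Finset.filter_subset _ _
    obtain ⟨v, hv, hvl⟩ := Finset.mem_image.1 (hU hl)
    have hvl' := hqsing l hla v hvl
    subst hvl'
    have hFT : frequent L s k ⊆ T := h.frequent_subset_of_violator hU hlt hv (hvl.symm ▸ hl)
      fun u _ huv => hqsing v hla u (huv.trans hvl)
    -- The values outside `T` are infrequent, and `M` sends them injectively to classes outside `U`.
    -- Thus |C| - |T| ≤ |C| - |U|, contradicting |T| < |U|.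
    have hCT : ∀ c ∈ palette L s \ T, c ∈ palette L s \ frequent L s k := fun c hc =>
      Finset.sdiff_subset_sdiff (Finset.Subset.refl _) hFT hc
    have hmaps : ∀ c ∈ palette L s \ T, q (M c) ∈ s.image q \ U := by
      intro c hc
      have hMc := mem_holders.1 (hMh c (hCT c hc))
      have hmem := Finset.mem_image_of_mem q hMc.1
      refine Finset.mem_sdiff.2 ⟨hmem, fun hqU => (Finset.mem_sdiff.1 hc).2 ?_⟩
      refine Finset.mem_biUnion.2 ⟨_, hqU, ?_⟩
      by_cases hpair : ∃ i ∈ Qs, q (M c) = a i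
      · obtain ⟨i, hi, hqi⟩ := hpair
        rw [hqi, hMab c (hCT c hc) i hi (hqpair _ i hi hqi)]
        exact hwclass i hi
      · push Not at hpair
        obtain ⟨ε, hε⟩ := mem_absList.1 hMc.2
        refine (mem_classColors hmem).2 ⟨ε, fun u _ hu => ?_⟩
        rwa [hqsing _ hpair u hu, ← hqsing _ hpair (M c) rfl]
    have hinj : Set.InjOn (fun c => q (M c)) (palette L s \ T : Finset α) := by
      intro c hc c' hc' hcc
      rw [Finset.mem_coe] at hc hc'
      change q (M c) = q (M c') at hcc
      by_cases hpair : ∃ i ∈ Qs, q (M c) = a i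
      · obtain ⟨i, hi, hqi⟩ := hpair
        rw [hMab c (hCT c hc) i hi (hqpair _ i hi hqi),
          hMab c' (hCT c' hc') i hi (hqpair _ i hi (hcc.symm.trans hqi))]
      · push Not at hpair
        have h1 := hqsing _ hpair (M c) rfl
        have h2 := hqsing _ hpair (M c') hcc.symm
        exact hM (hCT c hc) (hCT c' hc') (h1.trans h2.symm)
    have h1 := Finset.card_le_card_of_injOn _ hmaps hinj
    have h2 := Finset.card_sdiff_add_card_eq_card hTC
    have h3 := Finset.card_sdiff_add_card_eq_card hU
    omega

/-- In a minimal counterexample, there are fewer parts with at least three vertices than vertices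
in excess of the colors. -/
theorem card_partsOfCard_three_lt [Nonempty α] (h : MinimalCounterexample part L s k) :
    (partsOfCard part s 3).card + (palette L s).card < s.card := by
  by_contra! hcon
  have hClt := h.card_palette_lt
  obtain ⟨Qs, hQs, hQcard⟩ := Finset.exists_subset_card_eq
    (s := partsOfCard part s 3) (n := s.card - (palette L s).card) (by omega)
  have hcard : Qs.card + (palette L s).card = s.card := by omega
  have hQk : Qs.card ≤ k :=
    (Finset.card_le_card (hQs.trans (Finset.filter_subset _ _))).trans h.card_parts
  have hn := h.card_le
  obtain ⟨v₀, -⟩ := h.nonempty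
  have : Nonempty V := ⟨v₀⟩
  obtain ⟨f, hf, hft⟩ := Finset.exists_injOn_of_hall _ _ (h.hall_infrequent_and_parts hQs hcard)
  have hmeml : ∀ c ∈ palette L s \ frequent L s k, (Sum.inl c : α ⊕ ι × Bool) ∈
      (palette L s \ frequent L s k).disjSum (Qs ×ˢ (Finset.univ : Finset Bool)) :=
    fun c hc => Finset.inl_mem_disjSum.2 hc
  have hmemr : ∀ i ∈ Qs, ∀ β, (Sum.inr (i, β) : α ⊕ ι × Bool) ∈
      (palette L s \ frequent L s k).disjSum (Qs ×ˢ (Finset.univ : Finset Bool)) :=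
    fun i hi β => Finset.inr_mem_disjSum.2 (by simp [hi])
  set M : α → V := fun c => f (Sum.inl c) with hMdef
  set a : ι → V := fun i => f (Sum.inr (i, true)) with hadef
  set b : ι → V := fun i => f (Sum.inr (i, false)) with hbdef
  have hM : Set.InjOn M (palette L s \ frequent L s k : Finset α) := fun c hc c' hc' hcc =>
    Sum.inl_injective (hf (hmeml c hc) (hmeml c' hc') hcc)
  have hMh : ∀ c ∈ palette L s \ frequent L s k, M c ∈ holders L s c := fun c hc =>
    hft _ (hmeml c hc)
  have ha : ∀ i ∈ Qs, a i ∈ fiber part s i := fun i hi => hft _ (hmemr i hi true)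
  have hb : ∀ i ∈ Qs, b i ∈ fiber part s i := fun i hi => hft _ (hmemr i hi false)
  have hab : ∀ i ∈ Qs, a i ≠ b i := by
    intro i hi hi'
    simpa using hf (hmemr i hi true) (hmemr i hi false) hi'
  have hMa : ∀ c ∈ palette L s \ frequent L s k, ∀ i ∈ Qs, M c ≠ a i := by
    intro c hc i hi hci
    simpa using hf (hmeml c hc) (hmemr i hi true) hci
  have hMb : ∀ c ∈ palette L s \ frequent L s k, ∀ i ∈ Qs, M c ≠ b i := by
    intro c hc i hi hci
    simpa using hf (hmeml c hc) (hmemr i hi false) hci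
  by_cases hSDR : ∀ U ⊆ Qs, U.card ≤ (U.biUnion fun i => common L (a i) (b i)).card
  · obtain ⟨w, hw, hwc⟩ := Qs.exists_injOn_of_hall _ hSDR
    refine h.false_of_pairs hcard hM hMh ha hb hab hw hwc fun c hc i hi hci => ?_
    rcases hci with hci | hci
    · exact absurd hci (hMa c hc i hi)
    · exact absurd hci (hMb c hc i hi)
  push Not at hSDR
  obtain ⟨U, hUQ, hU⟩ := hSDR
  set Ω := U.biUnion fun i => common L (a i) (b i) with hΩ
  -- Each pair has at least 2k - |C| ≥ |Qs| - 1 common values. So Hall's condition can fail only if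
  -- all pairs have the same |Qs| - 1 common values.
  have hcom : ∀ i ∈ Qs, Qs.card ≤ (common L (a i) (b i)).card + 1 := by
    intro i hi
    have := h.le_card_palette_add_card_common (mem_fiber.1 (ha i hi)).1 (mem_fiber.1 (hb i hi)).1
    omega
  have hUcard := Finset.card_le_card hUQ
  obtain ⟨i₁, hi₁⟩ : U.Nonempty := by
    rw [← Finset.card_pos]
    omega
  have hsubΩ : ∀ i ∈ U, common L (a i) (b i) ⊆ Ω := fun i hi =>
    Finset.subset_biUnion_of_mem (fun i => common L (a i) (b i)) hi
  have hΩcard : Ω.card + 1 = Qs.card := by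
    have h1 := Finset.card_le_card (hsubΩ i₁ hi₁)
    have h2 := hcom i₁ (hUQ hi₁)
    omega
  have hUeq : U = Qs := by
    refine Finset.eq_of_subset_of_card_le hUQ ?_
    omega
  have hcomΩ : ∀ i ∈ Qs, common L (a i) (b i) = Ω := by
    intro i hi
    have h2 := hcom i hi
    exact Finset.eq_of_subset_of_card_le (hsubΩ i (hUeq.symm ▸ hi)) (by omega)
  -- The lists of a pair share at most 2|Ω| colors, so their union has at least 2|C|, that is, all
  -- of them.
  have hfull : ∀ i ∈ Qs, L (a i) ∪ L (b i) = palette L s ×ˢ (Finset.univ : Finset Bool) := by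
    intro i hi
    have has := (mem_fiber.1 (ha i hi)).1
    have hbs := (mem_fiber.1 (hb i hi)).1
    refine Finset.eq_of_subset_of_card_le ?_ ?_
    · intro χ hχ
      simp only [Finset.mem_product, Finset.mem_univ, and_true]
      rcases Finset.mem_union.1 hχ with hχ | hχ
      · exact absList_subset_palette has (mem_absList_of_mem hχ)
      · exact absList_subset_palette hbs (mem_absList_of_mem hχ)
    · rw [Finset.card_product, Finset.card_univ, Fintype.card_bool]
      have h1 := h.card_list _ has
      have h2 := h.card_list _ hbs
      have h3 := Finset.card_union_add_card_inter (L (a i)) (L (b i))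
      have h5 := card_le_of_fst_mem (M := L (a i) ∩ L (b i)) (D := Ω)
        (fun χ hχ => by
          rw [← hcomΩ i hi]
          exact Finset.mem_image_of_mem _ hχ)
      omega
  have hthird : ∀ i ∈ Qs, ∃ x ∈ fiber part s i, x ≠ a i ∧ x ≠ b i := by
    intro i hi
    by_contra! hno
    have h1 : fiber part s i ⊆ {a i, b i} := by
      intro x hx
      simp only [Finset.mem_insert, Finset.mem_singleton]
      by_cases hxa : x = a i
      · exact Or.inl hxa
      · exact Or.inr (hno x hx hxa)
    have h2 := Finset.card_le_card h1
    have h3 := Finset.card_le_two (a := a i) (b := b i)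
    have h4 := (mem_partsOfCard (by norm_num)).1 (hQs hi)
    omega
  choose! g hg hga hgb using hthird
  -- Such a color also lies in the list of `a i` or `b i`; the third vertex replaces the other
  -- member of that pair. If some third vertex is unmatched by `M`, its list has more than 2|Ω|
  -- colors. If all are matched, their |Qs| > |Ω| distinct values do not all lie in `Ω`.
  have hχ : ∃ i ∈ Qs, ∃ χ ∈ L (g i), χ.1 ∉ Ω ∧
      ∀ c ∈ palette L s \ frequent L s k, M c = g i → c = χ.1 := by
    by_cases hun : ∃ i ∈ Qs, ∀ c ∈ palette L s \ frequent L s k, M c ≠ g i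
    · obtain ⟨i, hi, hMg⟩ := hun
      refine ⟨i, hi, ?_⟩
      have h1 := h.card_list _ (mem_fiber.1 (hg i hi)).1
      by_contra! hno
      have h2 := card_le_of_fst_mem (M := L (g i)) (D := Ω) (by
        intro χ hχ
        by_contra hχΩ
        obtain ⟨c, hc, hcg, -⟩ := hno χ hχ hχΩ
        exact hMg c hc hcg)
      omega
    · push Not at hun
      choose! c hc hcg using hun
      have hcinj : Set.InjOn c Qs := by
        intro i hi j hj hij
        rw [← (mem_fiber.1 (hg i hi)).2, ← hcg i hi, hij, hcg j hj, (mem_fiber.1 (hg j hj)).2]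
      obtain ⟨x, hx, hxΩ⟩ := Finset.exists_mem_notMem_of_card_lt_card (s := Ω) (t := Qs.image c)
        (by
          rw [Finset.card_image_of_injOn hcinj]
          omega)
      obtain ⟨i, hi, rfl⟩ := Finset.mem_image.1 hx
      have h1 := (mem_holders.1 (hMh _ (hc i hi))).2
      rw [hcg i hi] at h1
      obtain ⟨ε, hε⟩ := mem_absList.1 h1
      exact ⟨i, hi, (c i, ε), hε, hxΩ, fun d hd hdg => hM hd (hc i hi) (hdg.trans (hcg i hi).symm)⟩
  obtain ⟨i₀, hi₀, χ, hχg, hχΩ, hχM⟩ := hχ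
  obtain ⟨w, hw, hwΩ⟩ := (Qs.erase i₀).exists_injOn_of_card_le (fun _ => Ω) (by
    intro i _
    rw [Finset.card_erase_of_mem hi₀]
    omega)
  obtain ⟨x, hx, hxab, hχx⟩ : ∃ x ∈ fiber part s i₀, (x = a i₀ ∨ x = b i₀) ∧ χ ∈ L x := by
    have h1 : χ ∈ L (a i₀) ∪ L (b i₀) := by
      rw [hfull i₀ hi₀]
      simpa using absList_subset_palette (mem_fiber.1 (hg i₀ hi₀)).1 (mem_absList_of_mem hχg)
    rcases Finset.mem_union.1 h1 with h1 | h1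
    · exact ⟨_, ha i₀ hi₀, Or.inl rfl, h1⟩
    · exact ⟨_, hb i₀ hi₀, Or.inr rfl, h1⟩
  have hne : ∀ i ∈ Qs, i ≠ i₀ → w i ∈ Ω := fun i hi hii => hwΩ i (Finset.mem_erase.2 ⟨hii, hi⟩)
  refine h.false_of_pairs hcard hM hMh (a := Function.update a i₀ x)
    (b := Function.update b i₀ (g i₀)) (w := Function.update w i₀ χ.1) ?_ ?_ ?_ ?_ ?_ ?_
  · intro i hi
    by_cases hii : i = i₀
    · subst hii
      simpa using hx
    · simpa [hii] using ha i hi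
  · intro i hi
    by_cases hii : i = i₀
    · subst hii
      simpa using hg i hi
    · simpa [hii] using hb i hi
  · intro i hi
    by_cases hii : i = i₀
    · subst hii
      simp only [Function.update_self]
      rcases hxab with rfl | rfl
      · exact (hga i hi).symm
      · exact (hgb i hi).symm
    · simpa [hii] using hab i hi
  · intro i hi j hj hij
    rw [Finset.mem_coe] at hi hj
    by_cases hii : i = i₀ <;> by_cases hjj : j = i₀
    · rw [hii, hjj]
    · subst hii
      simp only [Function.update_self, Function.update_of_ne hjj] at hij
      exact absurd (hij ▸ hne j hj hjj) hχΩ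
    · subst hjj
      simp only [Function.update_self, Function.update_of_ne hii] at hij
      exact absurd (hij ▸ hne i hi hii) hχΩ
    · simp only [Function.update_of_ne hii, Function.update_of_ne hjj] at hij
      exact hw (Finset.mem_coe.2 (Finset.mem_erase.2 ⟨hii, hi⟩))
        (Finset.mem_coe.2 (Finset.mem_erase.2 ⟨hjj, hj⟩)) hij
  · intro i hi
    by_cases hii : i = i₀
    · subst hii
      simp only [Function.update_self]
      exact mem_common.2 ⟨χ.2, hχx, hχg⟩
    · simp only [Function.update_of_ne hii]
      rw [hcomΩ i hi]
      exact hne i hi hii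
  · intro c hc i hi hci
    by_cases hii : i = i₀
    · subst hii
      simp only [Function.update_self] at hci ⊢
      rcases hci with hci | hci
      · rcases hxab with rfl | rfl
        · exact absurd hci (hMa c hc i hi)
        · exact absurd hci (hMb c hc i hi)
      · exact hχM c hc hci
    · simp only [Function.update_of_ne hii] at hci
      rcases hci with hci | hci
      · exact absurd hci (hMa c hc i hi)
      · exact absurd hci (hMb c hc i hi)

end MinimalCounterexample

end PartiteColoring

/-! ### Maximal partial colorings and near-acceptable labellings -/

namespace PartiteColoring

variable {V ι α : Type*} [DecidableEq V] [DecidableEq ι] [DecidableEq α]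

/-- The colors of `F` that are available with a suitable sign at all but at most `j` vertices
of `T`. -/
def nearlyCommon (L : V → Finset (α × Bool)) (T : Finset V) (j : ℕ) (F : Finset α) : Finset α :=
  F.filter fun c => ∃ ε, (T.filter fun v => (c, ε) ∉ L v).card ≤ j

/-- A value that is not nearly common is missing at `j + 1` or more vertices for each sign, which
takes 2(j + 1) off the maximal weight 2|T|. -/
theorem sum_weight_add_le (L : V → Finset (α × Bool)) (T : Finset V) (j : ℕ) (F : Finset α) :
    ∑ c ∈ F, weight L T c + F.card * (2 * (j + 1)) ≤
      F.card * (2 * T.card) + (nearlyCommon L T j F).card * (2 * (j + 1)) := by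
  have h1 : ∀ c ∈ F, weight L T c + 2 * (j + 1) ≤ 2 * T.card +
      if ∃ ε, (T.filter fun v => (c, ε) ∉ L v).card ≤ j then 2 * (j + 1) else 0 := by
    intro c _
    have h2 := Finset.card_filter_add_card_filter_not (s := T) (fun v => (c, true) ∈ L v)
    have h3 := Finset.card_filter_add_card_filter_not (s := T) (fun v => (c, false) ∈ L v)
    rw [weight_eq_sum_sign, Fintype.sum_bool]
    split_ifs with hc
    · omega
    · push Not at hc
      have h4 := hc true
      have h5 := hc false
      omega
  have h2 := Finset.sum_le_sum h1
  rw [Finset.sum_add_distrib, Finset.sum_add_distrib, Finset.sum_const, Finset.sum_const,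
    ← Finset.sum_filter, Finset.sum_const, smul_eq_mul, smul_eq_mul, smul_eq_mul] at h2
  exact h2

theorem exists_maximal_partialColoring [Nonempty α] (part : V → ι) (L : V → Finset (α × Bool))
    (Y : Finset V) (F : Finset α) :
    ∃ K ⊆ Y, ∃ g, IsPartialColoring part L K g ∧ (∀ v ∈ K, (g v).1 ∉ F) ∧
      ∀ K' ⊆ Y, ∀ g', IsPartialColoring part L K' g' → (∀ v ∈ K', (g' v).1 ∉ F) →
        K'.card ≤ K.card := by
  classical
  obtain ⟨K, hK, hmax⟩ := (Y.powerset.filter fun K =>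
    ∃ g, IsPartialColoring part L K g ∧ ∀ v ∈ K, (g v).1 ∉ F).exists_max_image Finset.card
    ⟨∅, by
      simp only [Finset.mem_filter, Finset.mem_powerset, Finset.empty_subset, true_and]
      exact ⟨fun _ => (Classical.arbitrary α, true), by simp [IsPartialColoring], by simp⟩⟩
  simp only [Finset.mem_filter, Finset.mem_powerset] at hK hmax
  obtain ⟨hKY, g, hg, hgF⟩ := hK
  exact ⟨K, hKY, g, hg, hgF, fun K' hK' g' hg' hg'F => hmax K' ⟨hK', g', hg', hg'F⟩⟩

section Maximal

variable {part : V → ι} {L : V → Finset (α × Bool)} {s Y K : Finset V} {F : Finset α}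
  {g : V → α × Bool} {i : ι}

/-- If one color class of a maximal partial coloring is replaced by vertices of one part, then it
does not become larger. -/
theorem weight_le_of_maximal (hKY : K ⊆ Y) (hg : IsPartialColoring part L K g)
    (hgF : ∀ v ∈ K, (g v).1 ∉ F)
    (hmax : ∀ K' ⊆ Y, ∀ g', IsPartialColoring part L K' g' → (∀ v ∈ K', (g' v).1 ∉ F) →
        K'.card ≤ K.card) (hi : fiber part s i ⊆ Y) {d : α} (hd : d ∉ F) :
    weight L ((fiber part s i).filter fun v => v ∉ K ∨ (g v).1 = d) d ≤
      2 * (K.filter fun v => (g v).1 = d).card := by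
  -- With the sign fixed, the class of `d` is discarded, and `d` is given to every vertex of the
  -- part that allows it and is uncolored or was in that class. Maximality compares the two classes.
  have key : ∀ ε : Bool, (((fiber part s i).filter fun v => v ∉ K ∨ (g v).1 = d).filter
      fun v => (d, ε) ∈ L v).card ≤ (K.filter fun v => (g v).1 = d).card := by
    intro ε
    set P := ((fiber part s i).filter fun v => v ∉ K ∨ (g v).1 = d).filter
      fun v => (d, ε) ∈ L v with hP
    have hPmem : ∀ v, v ∈ P ↔ (v ∈ fiber part s i ∧ (v ∉ K ∨ (g v).1 = d)) ∧ (d, ε) ∈ L v := by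
      intro v
      rw [hP, Finset.mem_filter, Finset.mem_filter]
    set K₁ := K.filter fun v => ¬ (g v).1 = d with hK₁
    have hdisj : Disjoint K₁ P := by
      rw [Finset.disjoint_left]
      intro v hv hvP
      rw [hK₁, Finset.mem_filter] at hv
      rcases ((hPmem v).1 hvP).1.2 with hvK | hvd
      · exact hvK hv.1
      · exact hv.2 hvd
    have hcard := hmax (K₁ ∪ P) (Finset.union_subset ((Finset.filter_subset _ _).trans hKY)
      fun v hv => hi ((hPmem v).1 hv).1.1) (fun v => if v ∈ P then (d, ε) else g v) (by
        constructor
        · intro v hv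
          by_cases hvP : v ∈ P
          · simp only [hvP, if_true]
            exact ((hPmem v).1 hvP).2
          · simp only [hvP, if_false]
            rcases Finset.mem_union.1 hv with hv | hv
            · exact hg.1 v (Finset.mem_filter.1 hv).1
            · exact absurd hv hvP
        · intro u hu v hv huv
          by_cases huP : u ∈ P <;> by_cases hvP : v ∈ P <;>
            simp only [huP, hvP, if_true, if_false] at huv ⊢
          · exact ⟨(mem_fiber.1 ((hPmem u).1 huP).1.1).2.trans
              (mem_fiber.1 ((hPmem v).1 hvP).1.1).2.symm, trivial⟩
          · have := (Finset.mem_union.1 hv).resolve_right hvP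
            exact absurd huv.symm (Finset.mem_filter.1 this).2
          · have := (Finset.mem_union.1 hu).resolve_right huP
            exact absurd huv (Finset.mem_filter.1 this).2
          · have h1 := (Finset.mem_union.1 hu).resolve_right huP
            have h2 := (Finset.mem_union.1 hv).resolve_right hvP
            exact hg.2 u (Finset.mem_filter.1 h1).1 v (Finset.mem_filter.1 h2).1 huv) (by
        intro v hv
        by_cases hvP : v ∈ P
        · simpa only [hvP, if_true] using hd
        · simp only [hvP, if_false]
          exact hgF v (Finset.mem_filter.1 ((Finset.mem_union.1 hv).resolve_right hvP)).1)
    rw [Finset.card_union_of_disjoint hdisj] at hcard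
    have h1 := Finset.card_filter_add_card_filter_not (s := K) (fun v => (g v).1 = d)
    change _ + K₁.card = _ at h1
    omega
  rw [weight_eq_sum_sign, Fintype.sum_bool]
  have h1 := key true
  have h2 := key false
  omega

/-- The exchange bound is summed over the values outside `F`. A colored vertex of the part
contributes at least one occurrence of its own value; this extra term later gains a unit by parity.
-/
theorem card_list_le_sum_weight_of_maximal {k : ℕ} (hL : ∀ v ∈ s, 2 * k ≤ (L v).card)
    (hKs : K ⊆ s) (hKY : K ⊆ Y) (hg : IsPartialColoring part L K g) (hgF : ∀ v ∈ K, (g v).1 ∉ F)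
    (hmax : ∀ K' ⊆ Y, ∀ g', IsPartialColoring part L K' g' → (∀ v ∈ K', (g' v).1 ∉ F) →
        K'.card ≤ K.card) (hi : fiber part s i ⊆ Y) :
    (fiber part (s \ K) i).card * (2 * k) + (fiber part K i).card ≤
      ∑ c ∈ F, weight L (fiber part (s \ K) i) c + 2 * K.card := by
  have hsplit : ∀ d ∈ palette L s \ F, weight L (fiber part (s \ K) i) d +
      ((fiber part K i).filter fun v => (g v).1 = d).card ≤
        2 * (K.filter fun v => (g v).1 = d).card := by
    intro d hd
    refine le_trans ?_ (weight_le_of_maximal hKY hg hgF hmax hi (Finset.mem_sdiff.1 hd).2)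
    have heq : ((fiber part s i).filter fun v => v ∉ K ∨ (g v).1 = d) =
        fiber part (s \ K) i ∪ ((fiber part K i).filter fun v => (g v).1 = d) := by
      ext v
      simp only [Finset.mem_filter, Finset.mem_union, mem_fiber, Finset.mem_sdiff]
      have := @hKs v
      tauto
    have hdisj : Disjoint (fiber part (s \ K) i)
        ((fiber part K i).filter fun v => (g v).1 = d) := by
      rw [Finset.disjoint_left]
      intro v hv hv'
      simp only [Finset.mem_filter, mem_fiber, Finset.mem_sdiff] at hv hv'
      exact hv.1.2 hv'.1.1
    rw [heq, weight, weight, Finset.sum_union hdisj]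
    refine Nat.add_le_add_left ?_ _
    rw [Finset.card_eq_sum_ones]
    refine Finset.sum_le_sum fun v hv => ?_
    rw [Finset.mem_filter, mem_fiber] at hv
    exact Finset.card_pos.2 ⟨g v, Finset.mem_filter.2 ⟨hg.1 v hv.1.1, hv.2⟩⟩
  have hcol : ∀ v ∈ K, (g v).1 ∈ palette L s \ F := fun v hv => Finset.mem_sdiff.2
    ⟨absList_subset_palette (hKs hv) (mem_absList_of_mem (hg.1 v hv)), hgF v hv⟩
  have h1 := Finset.sum_le_sum hsplit
  rw [Finset.sum_add_distrib, ← Finset.mul_sum,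
    ← Finset.card_eq_sum_card_fiberwise (s := K) (f := fun v => (g v).1) hcol,
    ← Finset.card_eq_sum_card_fiberwise (s := fiber part K i) (f := fun v => (g v).1)
      fun v hv => hcol v (mem_fiber.1 hv).1] at h1
  have h2 : (fiber part (s \ K) i).card * (2 * k) ≤
      ∑ c ∈ F, weight L (fiber part (s \ K) i) c +
        ∑ d ∈ palette L s \ F, weight L (fiber part (s \ K) i) d := by
    simp only [weight]
    rw [Finset.sum_comm, Finset.sum_comm (s := palette L s \ F), ← Finset.sum_add_distrib]
    refine Finset.card_nsmul_le_sum _ _ _ fun v hv => ?_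
    have hvs := (Finset.mem_sdiff.1 (mem_fiber.1 hv).1).1
    refine (hL v hvs).trans ?_
    rw [← Finset.sum_union Finset.disjoint_sdiff]
    refine (Finset.card_eq_sum_card_fiberwise (f := Prod.fst) fun χ hχ => ?_).le
    have := absList_subset_palette hvs (mem_absList_of_mem hχ)
    simp only [Finset.mem_coe, Finset.mem_union, Finset.mem_sdiff]
    tauto
  omega

end Maximal

/-- A system of distinct representatives for the vertices in `R` from the colors that are not in
`T`, where only vertices in `Z` may use their color `μ`. -/
theorem exists_injOn_of_private_colors [Nonempty α] {R Z : Finset V} (hZR : Z ⊆ R)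
    {μ : V → α} {F T : Finset α} (hcard : R.card + T.card ≤ (F ∪ Z.image μ).card) :
    ∃ ρ : V → α, Set.InjOn ρ R ∧
      ∀ v ∈ R, ρ v ∉ T ∧ (ρ v ∈ F ∨ v ∈ Z ∧ ρ v = μ v) := by
  obtain ⟨ρ, hρ, hρt⟩ := R.exists_injOn_of_hall
    (fun v => (F ∪ if v ∈ Z then {μ v} else ∅) \ T) (by
      intro U hU
      rcases U.eq_empty_or_nonempty with rfl | ⟨u, hu⟩
      · simp
      -- A value unavailable to `U` lies in `T` or is private to a vertex of `Z \ U`. So `U` has at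
      -- least |R| - |R \ U| = |U| values.
      have hsub : F ∪ Z.image μ ⊆
          U.biUnion (fun v => (F ∪ if v ∈ Z then {μ v} else ∅) \ T) ∪ T ∪ (Z \ U).image μ := by
        intro c hc
        by_cases hcT : c ∈ T
        · exact Finset.mem_union_left _ (Finset.mem_union_right _ hcT)
        rcases Finset.mem_union.1 hc with hc | hc
        · refine Finset.mem_union_left _ (Finset.mem_union_left _ (Finset.mem_biUnion.2
            ⟨u, hu, Finset.mem_sdiff.2 ⟨Finset.mem_union_left _ hc, hcT⟩⟩))
        · obtain ⟨z, hz, rfl⟩ := Finset.mem_image.1 hc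
          by_cases hzU : z ∈ U
          · refine Finset.mem_union_left _ (Finset.mem_union_left _ (Finset.mem_biUnion.2
              ⟨z, hzU, Finset.mem_sdiff.2 ⟨Finset.mem_union_right _ (by simp [hz]), hcT⟩⟩))
          · exact Finset.mem_union_right _ (Finset.mem_image_of_mem μ
              (Finset.mem_sdiff.2 ⟨hz, hzU⟩))
      have h1 := Finset.card_le_card hsub
      have h2 := Finset.card_union_le
        (U.biUnion (fun v => (F ∪ if v ∈ Z then {μ v} else ∅) \ T) ∪ T) ((Z \ U).image μ)
      have h3 := Finset.card_union_le
        (U.biUnion (fun v => (F ∪ if v ∈ Z then {μ v} else ∅) \ T)) T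
      have h4 : ((Z \ U).image μ).card ≤ (Z \ U).card := Finset.card_image_le
      have h5 := Finset.card_le_card (Finset.sdiff_subset_sdiff hZR (Finset.Subset.refl U))
      have h6 := Finset.card_sdiff_add_card_eq_card hU
      omega)
  refine ⟨ρ, hρ, fun v hv => ?_⟩
  have h1 := Finset.mem_sdiff.1 (hρt v hv)
  refine ⟨h1.2, ?_⟩
  rcases Finset.mem_union.1 h1.1 with h2 | h2
  · exact Or.inl h2
  · by_cases hvZ : v ∈ Z
    · simp only [hvZ, if_true, Finset.mem_singleton] at h2
      exact Or.inr ⟨hvZ, h2⟩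
    · simp [hvZ] at h2

namespace MinimalCounterexample

variable {part : V → ι} {L : V → Finset (α × Bool)} {s : Finset V} {k : ℕ}

/-- A partial coloring avoiding the colors in `F ∪ Z.image μ` cannot be completed to a nearly
acceptable one. -/
theorem false_of_nearlyCommon [Nonempty α] (h : MinimalCounterexample part L s k)
    {F : Finset α} (hF : F ⊆ frequent L s k) {Z : Finset V} {μ : V → α}
    (hμL : ∀ z ∈ Z, μ z ∈ absList L z)
    {K : Finset V} {g : V → α × Bool} (hg : IsPartialColoring part L K g)
    (hgF : ∀ v ∈ K, (g v).1 ∉ F ∪ Z.image μ) {I : Finset ι} {c : ι → α} (hc : Set.InjOn c I)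
    (hcF : ∀ i ∈ I, c i ∈ F ∪ Z.image μ) (e : ι → Bool) {R : Finset V}
    (hR : R = (s \ K).filter fun v => ¬ (part v ∈ I ∧ (c (part v), e (part v)) ∈ L v))
    (hZR : Z ⊆ R) (hcard : R.card + I.card ≤ (F ∪ Z.image μ).card) : False := by
  obtain ⟨ρ, hρ, hρR⟩ := exists_injOn_of_private_colors (T := I.image c) hZR
    (by rwa [Finset.card_image_of_injOn hc])
  have hρF : ∀ v ∈ R, ρ v ∈ F ∪ Z.image μ := by
    intro v hv
    rcases (hρR v hv).2 with h1 | ⟨h1, h2⟩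
    · exact Finset.mem_union_left _ h1
    · rw [h2]
      exact Finset.mem_union_right _ (Finset.mem_image_of_mem μ h1)
  have hcases : ∀ v ∈ s, v ∈ K ∨ (v ∉ K ∧ v ∈ R) ∨
      (v ∉ K ∧ v ∉ R ∧ part v ∈ I ∧ (c (part v), e (part v)) ∈ L v) := by
    intro v hv
    by_cases hvK : v ∈ K
    · exact Or.inl hvK
    · by_cases hvR : v ∈ R
      · exact Or.inr (Or.inl ⟨hvK, hvR⟩)
      · refine Or.inr (Or.inr ⟨hvK, hvR, ?_⟩)
        by_contra hcon
        exact hvR (hR ▸ Finset.mem_filter.2 ⟨Finset.mem_sdiff.2 ⟨hv, hvK⟩, hcon⟩)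
  -- Vertices of `K` keep their values and those allowing the value of their part take it. The rest
  -- are singletons, with a frequent value or a private one from their own list.
  let f : V → α := fun v => if v ∈ K then (g v).1 else if v ∈ R then ρ v else c (part v)
  have f1 : ∀ v, v ∈ K → f v = (g v).1 := fun v hv => by simp [f, hv]
  have f2 : ∀ v, v ∉ K → v ∈ R → f v = ρ v := fun v hv hv' => by simp [f, hv, hv']
  have f3 : ∀ v, v ∉ K → v ∉ R → f v = c (part v) := fun v hv hv' => by simp [f, hv, hv']
  have n12 : ∀ u v, u ∈ K → v ∉ K → v ∈ R → f u ≠ f v := by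
    intro u v hu hv hvR huv
    rw [f1 u hu, f2 v hv hvR] at huv
    exact hgF u hu (huv ▸ hρF v hvR)
  have n13 : ∀ u v, u ∈ K → v ∉ K → v ∉ R → part v ∈ I → f u ≠ f v := by
    intro u v hu hv hvR hvI huv
    rw [f1 u hu, f3 v hv hvR] at huv
    exact hgF u hu (huv ▸ hcF _ hvI)
  have n23 : ∀ u v, u ∉ K → u ∈ R → v ∉ K → v ∉ R → part v ∈ I → f u ≠ f v := by
    intro u v hu huR hv hvR hvI huv
    rw [f2 u hu huR, f3 v hv hvR] at huv
    exact (hρR u huR).1 (huv ▸ Finset.mem_image_of_mem c hvI)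
  refine h.false_of_near_acceptable f ?_ ?_
  · intro u hu v hv huv
    rcases hcases u hu with hu1 | ⟨hu1, hu2⟩ | ⟨hu1, hu2, hu3, hu4⟩ <;>
      rcases hcases v hv with hv1 | ⟨hv1, hv2⟩ | ⟨hv1, hv2, hv3, hv4⟩
    · rw [f1 u hu1, f1 v hv1] at huv
      exact (hg.2 u hu1 v hv1 huv).1
    · exact absurd huv (n12 u v hu1 hv1 hv2)
    · exact absurd huv (n13 u v hu1 hv1 hv2 hv3)
    · exact absurd huv.symm (n12 v u hv1 hu1 hu2)
    · rw [f2 u hu1 hu2, f2 v hv1 hv2] at huv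
      rw [hρ hu2 hv2 huv]
    · exact absurd huv (n23 u v hu1 hu2 hv1 hv2 hv3)
    · exact absurd huv.symm (n13 v u hv1 hu1 hu2 hu3)
    · exact absurd huv.symm (n23 v u hv1 hv2 hu1 hu2 hu3)
    · rw [f3 u hu1 hu2, f3 v hv1 hv2] at huv
      exact hc hu3 hv3 huv
  · intro v hv
    rcases hcases v hv with hv1 | ⟨hv1, hv2⟩ | ⟨hv1, hv2, hv3, hv4⟩
    · left
      refine ⟨(g v).2, fun u hu huv => ?_⟩
      rcases hcases u hu with hu1 | ⟨hu1, hu2⟩ | ⟨hu1, hu2, hu3, hu4⟩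
      · rw [f1 u hu1, f1 v hv1] at huv
        rw [f1 v hv1, Prod.mk.eta, ← (hg.2 u hu1 v hv1 huv).2]
        exact hg.1 u hu1
      · exact absurd huv.symm (n12 v u hv1 hu1 hu2)
      · exact absurd huv.symm (n13 v u hv1 hu1 hu2 hu3)
    · have hsing : ∀ u ∈ s, f u = f v → u = v := by
        intro u hu huv
        rcases hcases u hu with hu1 | ⟨hu1, hu2⟩ | ⟨hu1, hu2, hu3, hu4⟩
        · exact absurd huv (n12 u v hu1 hv1 hv2)
        · rw [f2 u hu1 hu2, f2 v hv1 hv2] at huv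
          exact hρ hu2 hv2 huv
        · exact absurd huv.symm (n23 v u hv1 hv2 hu1 hu2 hu3)
      rcases (hρR v hv2).2 with h1 | ⟨h1, h2⟩
      · right
        rw [f2 v hv1 hv2]
        refine ⟨hF h1, ?_⟩
        rwa [f2 v hv1 hv2] at hsing
      · left
        obtain ⟨ε, hε⟩ := mem_absList.1 (hμL v h1)
        refine ⟨ε, fun u hu huv => ?_⟩
        rw [hsing u hu huv, f2 v hv1 hv2, h2]
        exact hε
    · left
      refine ⟨e (part v), fun u hu huv => ?_⟩
      rcases hcases u hu with hu1 | ⟨hu1, hu2⟩ | ⟨hu1, hu2, hu3, hu4⟩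
      · exact absurd huv (n13 u v hu1 hv1 hv2 hv3)
      · exact absurd huv (n23 u v hu1 hu2 hv1 hv2 hv3)
      · have huv' := huv
        rw [f3 u hu1 hu2, f3 v hv1 hv2] at huv'
        have hp := hc hu3 hv3 huv'
        rw [f3 v hv1 hv2, ← hp]
        exact hu4

end MinimalCounterexample

end PartiteColoring

/-! ### The final count -/

namespace PartiteColoring

variable {V ι α : Type*} [DecidableEq V] [DecidableEq ι] [DecidableEq α]

namespace MinimalCounterexample

variable {part : V → ι} {L : V → Finset (α × Bool)} {s : Finset V} {k : ℕ}

/-- The two lists would be disjoint, so |C| ≥ 2k. Then |s| - |C| ≤ 1 rules out parts with three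
vertices, whence |s| ≤ 2k ≤ |C|, which is impossible. -/
theorem card_fiber_ne_two [Nonempty α] (h : MinimalCounterexample part L s k) (i : ι) :
    (fiber part s i).card ≠ 2 := by
  intro hi
  obtain ⟨u, v, huv, heq⟩ := Finset.card_eq_two.1 hi
  have hu : u ∈ s := (mem_fiber.1 (heq ▸ Finset.mem_insert_self u {v} : u ∈ fiber part s i)).1
  have hv : v ∈ s := (mem_fiber.1 (heq ▸ Finset.mem_insert_of_mem (Finset.mem_singleton_self v) :
    v ∈ fiber part s i)).1
  have hdisj : Disjoint (L u) (L v) := by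
    rw [Finset.disjoint_left]
    intro χ hχu hχv
    obtain ⟨w, hw, hχw⟩ := h.not_forall_fiber_mem hi.ge χ
    rw [heq, Finset.mem_insert, Finset.mem_singleton] at hw
    rcases hw with rfl | rfl
    · exact hχw hχu
    · exact hχw hχv
  have h1 := h.card_list u hu
  have h2 := h.card_list v hv
  have h3 := card_le_of_fst_mem (M := L u ∪ L v) (D := palette L s) (by
    intro χ hχ
    rcases Finset.mem_union.1 hχ with hχ | hχ
    · exact absList_subset_palette hu (mem_absList_of_mem hχ)
    · exact absList_subset_palette hv (mem_absList_of_mem hχ))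
  rw [Finset.card_union_of_disjoint hdisj] at h3
  have h4 := h.card_partsOfCard_three_lt
  have h5 := h.card_le
  have h6 : ∀ j ∈ s.image part, (fiber part s j).card ≤ 2 := by
    intro j _
    by_contra! hcon
    have hj : j ∈ partsOfCard part s 3 := (mem_partsOfCard (by norm_num)).2 hcon
    have := Finset.card_pos.2 ⟨j, hj⟩
    omega
  have h7 := Finset.sum_le_card_nsmul _ _ _ h6
  rw [← card_eq_sum_fiber, smul_eq_mul] at h7
  have h8 := h.card_parts
  omega

/-- Color as many vertices of nonsingleton parts as possible outside the reserve `F'`. Each part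
with two or more vertices left gets a value of `F'` missing at most one of them. The leftover
vertices, at most one per part, use up the rest of `F'`. -/
theorem false_of_maximal_partialColoring [Nonempty α] (h : MinimalCounterexample part L s k)
    {F : Finset α} (hF : F ⊆ frequent L s k) {Z : Finset V} (hZs : Z ⊆ s)
    (hZ : ∀ z ∈ Z, (fiber part s (part z)).card ≤ 1) {μ : V → α}
    (hμL : ∀ z ∈ Z, μ z ∈ absList L z) (hparts : (s.image part).card ≤ (F ∪ Z.image μ).card)
    (hk : (F ∪ Z.image μ).card ≤ k) : False := by
  set F' := F ∪ Z.image μ with hF'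
  set Y := s.filter fun v => 2 ≤ (fiber part s (part v)).card with hY
  obtain ⟨K, hKY, g, hg, hgF, hmax⟩ := exists_maximal_partialColoring part L Y F'
  have hKs : K ⊆ s := hKY.trans (Finset.filter_subset _ _)
  set I := partsOfCard part (s \ K) 2 with hI
  have hI2 : ∀ i, i ∈ I ↔ 2 ≤ (fiber part (s \ K) i).card := fun i =>
    mem_partsOfCard (by norm_num)
  have hfibsub : ∀ i, fiber part (s \ K) i ⊆ fiber part s i := fun i v hv =>
    mem_fiber.2 ⟨(Finset.mem_sdiff.1 (mem_fiber.1 hv).1).1, (mem_fiber.1 hv).2⟩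
  have hIY : ∀ i ∈ I, fiber part s i ⊆ Y := by
    intro i hi v hv
    have h1 := Finset.card_le_card (hfibsub i)
    have h2 := (hI2 i).1 hi
    rw [hY, Finset.mem_filter, (mem_fiber.1 hv).2]
    exact ⟨(mem_fiber.1 hv).1, by omega⟩
  have hΦ : ∀ i ∈ I, 4 * k + (fiber part K i).card ≤
      2 * F'.card + 2 * (nearlyCommon L (fiber part (s \ K) i) 0 F').card + 2 * K.card := by
    intro i hi
    have h1 := card_list_le_sum_weight_of_maximal h.card_list hKs hKY hg hgF hmax (hIY i hi)
    have h2 := sum_weight_add_le L (fiber part (s \ K) i) 0 F'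
    have h3 := (hI2 i).1 hi
    obtain ⟨r, rfl⟩ := Nat.exists_eq_add_of_le hk
    generalize (fiber part (s \ K) i).card = v at *
    have h4 : 2 * r ≤ v * r := Nat.mul_le_mul_right r h3
    have h5 : v * (2 * (F'.card + r)) = F'.card * (2 * v) + 2 * (v * r) := by ring
    omega
  have hΨ : ∀ i ∈ I, 4 * k ≤
      4 * (nearlyCommon L (fiber part (s \ K) i) 1 F').card + 2 * K.card := by
    intro i hi
    have h1 := card_list_le_sum_weight_of_maximal h.card_list hKs hKY hg hgF hmax (hIY i hi)
    have h2 := sum_weight_add_le L (fiber part (s \ K) i) 1 F'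
    have h3 := (hI2 i).1 hi
    obtain ⟨r, rfl⟩ := Nat.exists_eq_add_of_le hk
    generalize (fiber part (s \ K) i).card = v at *
    have h4 : 2 * r ≤ v * r := Nat.mul_le_mul_right r h3
    have h5 : v * (2 * (F'.card + r)) = F'.card * (2 * v) + 2 * (v * r) := by ring
    omega
  have hn := h.card_le
  have hsK := Finset.card_sdiff_add_card_eq_card hKs
  have hsum := card_eq_sum_fiber part (s \ K)
  have hpartsK : ((s \ K).image part).card ≤ (s.image part).card :=
    Finset.card_le_card (Finset.image_subset_image Finset.sdiff_subset)
  have hIimg : I ⊆ (s \ K).image part := Finset.filter_subset _ _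
  have hpos : ∀ i ∈ (s \ K).image part, 1 ≤ (fiber part (s \ K) i).card := by
    intro i hi
    obtain ⟨v, hv, rfl⟩ := Finset.mem_image.1 hi
    exact Finset.card_pos.2 ⟨v, mem_fiber.2 ⟨hv, rfl⟩⟩
  have hind : ∑ i ∈ (s \ K).image part, (1 + if i ∈ I then 1 else 0) =
      ((s \ K).image part).card + I.card := by
    rw [Finset.sum_add_distrib, ← Finset.card_eq_sum_ones, ← Finset.sum_filter,
      ← Finset.card_eq_sum_ones, Finset.filter_mem_eq_inter, Finset.inter_eq_right.2 hIimg]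
  have hle : ∀ i ∈ (s \ K).image part,
      (1 + if i ∈ I then 1 else 0) ≤ (fiber part (s \ K) i).card := by
    intro i hi
    split_ifs with hiI
    · exact (hI2 i).1 hiI
    · exact hpos i hi
  have hcount : ((s \ K).image part).card + I.card ≤ (s \ K).card := by
    rw [hsum, ← hind]
    exact Finset.sum_le_sum hle
  have hIimgcard := Finset.card_le_card hIimg
  -- `m` counts parts that can be given a value missing no remaining vertex. If every part of `I`
  -- meets `K`, parity improves its bound by one. Otherwise some part of `I` is untouched and has at
  -- least three vertices, which improves the count of vertices by one.
  obtain ⟨m, hm1, hm2⟩ : ∃ m, (∀ i ∈ I,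
      m ≤ (nearlyCommon L (fiber part (s \ K) i) 0 F').card) ∧
        ((s \ K).image part).card + I.card ≤ F'.card + m := by
    by_cases hcov : ∀ i ∈ I, (fiber part K i).Nonempty
    · refine ⟨2 * k + 1 - F'.card - K.card, fun i hi => ?_, by omega⟩
      have h1 := hΦ i hi
      have h2 := Finset.card_pos.2 (hcov i hi)
      omega
    · push Not at hcov
      obtain ⟨i, hi, hiK⟩ := hcov
      refine ⟨2 * k - F'.card - K.card, fun j hj => ?_, ?_⟩
      · have h1 := hΦ j hj
        omega
      · have h3 : fiber part (s \ K) i = fiber part s i := by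
          refine Finset.Subset.antisymm (hfibsub i) fun v hv => ?_
          refine mem_fiber.2 ⟨Finset.mem_sdiff.2 ⟨(mem_fiber.1 hv).1, fun hvK => ?_⟩,
            (mem_fiber.1 hv).2⟩
          have : v ∈ fiber part K i := mem_fiber.2 ⟨hvK, (mem_fiber.1 hv).2⟩
          simp [hiK] at this
        have h4 := h.card_fiber_ne_two i
        have h5 := (hI2 i).1 hi
        rw [← h3] at h4
        have h6 : ((s \ K).image part).card + I.card < (s \ K).card := by
          rw [hsum, ← hind]
          refine Finset.sum_lt_sum hle ⟨i, hIimg hi, ?_⟩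
          simp only [hi, if_true]
          omega
        omega
  obtain ⟨I', hI'I, hI'⟩ := Finset.exists_subset_card_eq (s := I) (n := min m I.card)
    (min_le_right _ _)
  -- Sets inside `I'` have at least `m` values by `hm1`; any other set contains a part to which `hΨ`
  -- gives at least |I| values.
  obtain ⟨c, hc, hct⟩ := I.exists_injOn_of_hall
    (fun i => nearlyCommon L (fiber part (s \ K) i) (if i ∈ I' then 0 else 1) F') (by
      intro U hU
      by_cases hUI : U ⊆ I'
      · rcases U.eq_empty_or_nonempty with rfl | ⟨i, hi⟩
        · simp
        have h1 := Finset.card_le_card (Finset.subset_biUnion_of_mem (fun i =>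
          nearlyCommon L (fiber part (s \ K) i) (if i ∈ I' then 0 else 1) F') hi)
        simp only [hUI hi, if_true] at h1
        have h2 := hm1 i (hU hi)
        have h3 := Finset.card_le_card hUI
        omega
      · obtain ⟨i, hi, hiI⟩ := Finset.not_subset.1 hUI
        have h1 := Finset.card_le_card (Finset.subset_biUnion_of_mem (fun i =>
          nearlyCommon L (fiber part (s \ K) i) (if i ∈ I' then 0 else 1) F') hi)
        simp only [hiI, if_false] at h1
        have h2 := hΨ i (hU hi)
        have h3 := Finset.card_le_card hU
        omega)
  simp only [nearlyCommon, Finset.mem_filter] at hct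
  choose! hcF e he using hct
  set R := (s \ K).filter fun v => ¬ (part v ∈ I ∧ (c (part v), e (part v)) ∈ L v) with hR
  have hRfib : ∀ v ∈ R, v ∈ fiber part (s \ K) (part v) := fun v hv =>
    mem_fiber.2 ⟨(Finset.mem_filter.1 hv).1, rfl⟩
  have hRmiss : ∀ v ∈ R, part v ∈ I →
      v ∈ (fiber part (s \ K) (part v)).filter fun v => (c (part v), e (part v)) ∉ L v := by
    intro v hv hvI
    exact Finset.mem_filter.2 ⟨hRfib v hv, fun hcv => (Finset.mem_filter.1 hv).2 ⟨hvI, hcv⟩⟩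
  have hRI' : ∀ v ∈ R, part v ∉ I' := by
    intro v hv hvI
    have h1 := he _ (hI'I hvI)
    rw [if_pos hvI, Nat.le_zero, Finset.card_eq_zero] at h1
    have h2 := hRmiss v hv (hI'I hvI)
    rw [Finset.filter_congr (q := fun u => (c (part v), e (part v)) ∉ L u)
      (fun u hu => by rw [(mem_fiber.1 hu).2]), h1] at h2
    simp at h2
  have hRinj : Set.InjOn part R := by
    intro u hu v hv huv
    rw [Finset.mem_coe] at hu hv
    have huf := hRfib u hu
    have hvf := hRfib v hv
    by_cases hvI : part v ∈ I
    · have h1 := he _ hvI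
      have hum := hRmiss u hu (huv ▸ hvI)
      have hvm := hRmiss v hv hvI
      have hmem : ∀ x ∈ R, part x = part v →
          x ∈ (fiber part (s \ K) (part v)).filter fun u => (c (part v), e (part v)) ∉ L u := by
        intro x hx hxv
        refine Finset.mem_filter.2 ⟨hxv ▸ hRfib x hx, fun hcx => ?_⟩
        exact (Finset.mem_filter.1 hx).2 ⟨hxv ▸ hvI, by rwa [hxv]⟩
      refine Finset.card_le_one.1 (h1.trans (by split_ifs <;> omega)) u (hmem u hu huv) v
        (hmem v hv rfl)
    · rw [hI2] at hvI
      exact Finset.card_le_one.1 (by omega) u (huv ▸ huf) v hvf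
  have hRcard : R.card + I'.card ≤ ((s \ K).image part).card := by
    have h1 := Finset.card_le_card_of_injOn (s := R) (t := (s \ K).image part \ I') part
      (fun v hv => Finset.mem_coe.2 (Finset.mem_sdiff.2
        ⟨Finset.mem_image_of_mem part (Finset.mem_filter.1 hv).1, hRI' v hv⟩)) hRinj
    have h2 := Finset.card_sdiff_add_card_eq_card (hI'I.trans hIimg)
    omega
  have hZR : Z ⊆ R := by
    intro z hz
    have h1 := hZ z hz
    have hzK : z ∉ K := by
      intro hzK
      have := (Finset.mem_filter.1 (hKY hzK)).2
      omega
    refine Finset.mem_filter.2 ⟨Finset.mem_sdiff.2 ⟨hZs hz, hzK⟩, fun hzI => ?_⟩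
    have h2 := (hI2 _).1 hzI.1
    have h3 := Finset.card_le_card (hfibsub (part z))
    omega
  -- For |I'| = m this is `hm2`; for |I'| = |I| the left side is at most the number of parts.
  have hfinal : R.card + I.card ≤ F'.card := by omega
  exact h.false_of_nearlyCommon hF hμL hg hgF hc hcF e hR hZR hfinal

/-- There is no minimal counterexample. -/
theorem elim [Nonempty α] (h : MinimalCounterexample part L s k) : False := by
  have hlt := h.card_partsOfCard_three_lt
  have hx := h.card_le_card_palette_add_card_frequent
  have hr := h.card_parts
  -- The reserve is filled up to at most `k` values, with frequent values first and then private
  -- values of singleton parts.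
  obtain ⟨F, hF, hFcard⟩ := Finset.exists_subset_card_eq (s := frequent L s k)
    (n := min (frequent L s k).card k) (min_le_left _ _)
  set Z := s.filter fun v => (fiber part s (part v)).card ≤ 1 with hZ
  obtain ⟨Z₀, hZ₀, hZ₀card⟩ := Finset.exists_subset_card_eq (s := Z)
    (n := min Z.card (k - F.card)) (min_le_left _ _)
  have hZ₀s : Z₀ ⊆ s := hZ₀.trans (Finset.filter_subset _ _)
  obtain ⟨μ, hμ, hμL⟩ := Z₀.exists_injOn_of_card_le (fun z => absList L z \ F) (by
    intro z hz
    have h1 := h.le_card_absList (hZ₀s hz)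
    have h2 := Finset.le_card_sdiff F (absList L z)
    omega)
  have hcard : (F ∪ Z₀.image μ).card = F.card + Z₀.card := by
    rw [Finset.card_union_of_disjoint, Finset.card_image_of_injOn hμ]
    rw [Finset.disjoint_right]
    intro c hc
    obtain ⟨z, hz, rfl⟩ := Finset.mem_image.1 hc
    exact (Finset.mem_sdiff.1 (hμL z hz)).2
  have hparts : (s.image part).card ≤ Z.card + (partsOfCard part s 3).card := by
    have h1 : s.image part ⊆ Z.image part ∪ partsOfCard part s 3 := by
      intro i hi
      obtain ⟨v, hv, rfl⟩ := Finset.mem_image.1 hi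
      by_cases hvZ : v ∈ Z
      · exact Finset.mem_union_left _ (Finset.mem_image_of_mem part hvZ)
      · refine Finset.mem_union_right _ ((mem_partsOfCard (by norm_num)).2 ?_)
        have h2 := h.card_fiber_ne_two (part v)
        have h3 : ¬ (fiber part s (part v)).card ≤ 1 := fun h3 =>
          hvZ (Finset.mem_filter.2 ⟨hv, h3⟩)
        omega
    have h2 := Finset.card_le_card h1
    have h3 := Finset.card_union_le (Z.image part) (partsOfCard part s 3)
    have h4 : (Z.image part).card ≤ Z.card := Finset.card_image_le
    omega
  refine h.false_of_maximal_partialColoring hF hZ₀s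
    (fun z hz => (Finset.mem_filter.1 (hZ₀ hz)).2)
    (fun z hz => (Finset.mem_sdiff.1 (hμL z hz)).1) ?_ ?_
  -- If the reserve has fewer than `k` values, it uses all of `Z` and all frequent values. The parts
  -- number at most |Z| plus the large parts, hence less than |Z| + |s| - |C|, and |s| - |C| is at
  -- most the number of frequent values.
  · omega
  · omega

end MinimalCounterexample

/-- The complete expansion of a complete multipartite graph with at most `k` parts and at most
`2 * k + 1` vertices is colorable from lists of size `2 * k`. -/
theorem colorable_of_card_le [Nonempty α] (part : V → ι) (L : V → Finset (α × Bool))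
    (s : Finset V) (k : ℕ) (hparts : (s.image part).card ≤ k) (hs : s.card ≤ 2 * k + 1)
    (hL : ∀ v ∈ s, 2 * k ≤ (L v).card) : Colorable part L s := by
  induction s using Finset.strongInduction generalizing L k with
  | H s ih =>
    by_contra hcon
    exact MinimalCounterexample.elim (part := part) (L := L) (s := s) (k := k)
      ⟨hparts, hs, hL, fun t ht L' k' h1 h2 h3 => ih t ht L' k' h1 h2 h3, hcon⟩

end PartiteColoring

/-! ### Translation to integer colors and the lower bound -/

namespace SimpleGraph.IsCompletePartite

variable {V : Type*} {G : SimpleGraph V} {k : ℕ}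

theorem isZeroFreeChoosable_completeExpansion [Fintype V] (hG : G.IsCompletePartite k)
    (hV : Fintype.card V ≤ 2 * k + 1) : G.completeExpansion.IsZeroFreeChoosable (2 * k) := by
  classical
  obtain ⟨part, -, hpart⟩ := hG
  intro L hL0 hL
  have hsub : ∀ v, ∃ T : Finset ℤ, (T : Set ℤ) ⊆ L v ∧ T.card = 2 * k := by
    intro v
    obtain ⟨t, ht, htc⟩ := Set.exists_subset_encard_eq (hL v)
    have hfin : t.Finite := Set.finite_of_encard_eq_coe htc
    refine ⟨hfin.toFinset, by simpa using ht, ?_⟩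
    rw [hfin.encard_eq_coe_toFinset_card] at htc
    exact_mod_cast htc
  choose T hTL hTcard using hsub
  have hT0 : ∀ v, ∀ z ∈ T v, z ≠ 0 := by
    rintro v z hz rfl
    exact hL0 v (hTL v hz)
  obtain ⟨φ, hφL, hφ⟩ := PartiteColoring.colorable_of_card_le part
    (fun v => (T v).image fun z => (z.natAbs, decide (0 < z))) Finset.univ k
    ((Finset.card_le_univ _).trans (by simp)) hV (by
      intro v _
      rw [Finset.card_image_of_injOn, hTcard]
      intro x hx y hy hxy
      simp only [Prod.mk.injEq, decide_eq_decide] at hxy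
      have := hT0 v x hx
      have := hT0 v y hy
      omega)
  simp only [Finset.mem_univ, Finset.mem_image, true_implies] at hφL hφ
  choose f hfT hf using hφL
  refine ⟨f, ?_, fun v => hTL v (hfT v)⟩
  have key : ∀ u v, (f u).natAbs = (f v).natAbs →
      part u = part v ∧ (0 < f u ↔ 0 < f v) := by
    intro u v huv
    have h1 := hφ u v (by rw [← hf u, ← hf v]; exact huv)
    refine ⟨h1.1, ?_⟩
    have h2 := h1.2
    rw [← hf u, ← hf v] at h2
    simpa only [decide_eq_decide] using (Prod.mk.inj h2).2
  rintro ε u v (⟨rfl, huv⟩ | ⟨rfl, -⟩) heq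
  · simp only [Units.val_one, one_mul] at heq
    exact (hpart u v).1 huv (key u v (by rw [heq])).1
  · simp only [Units.val_neg, Units.val_one, neg_mul, one_mul] at heq
    have h1 := (key u v (by rw [heq, Int.natAbs_neg])).2
    -- Zero must be excluded here, being its own negative.
    have h2 := hT0 v _ (hfT v)
    omega

theorem le_of_isZeroFreeChoosable_completeExpansion (hG : G.IsCompletePartite k) {m : ℕ}
    (hm : G.completeExpansion.IsZeroFreeChoosable (2 * m)) : k ≤ m := by
  obtain ⟨part, hsurj, hpart⟩ := hG
  obtain ⟨f, hf, hfL⟩ := hm (fun _ => ((Finset.Icc (-(m : ℤ)) m).erase 0 : Finset ℤ))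
    (fun v => by simp) (fun v => by
      rw [Set.encard_coe_eq_coe_finsetCard, Finset.card_erase_of_mem (by simp), Int.card_Icc]
      exact_mod_cast (by omega))
  simp only [Finset.mem_coe, Finset.mem_erase, Finset.mem_Icc] at hfL
  choose r hr using hsurj
  have hinj : Set.InjOn (fun i => (f (r i)).natAbs) (Finset.univ : Finset (Fin k)) := by
    intro i _ j _ hij
    by_contra hne
    have hadj : G.Adj (r i) (r j) := (hpart _ _).2 (by rwa [hr, hr])
    have h1 := hf 1 (r i) (r j) (Or.inl ⟨rfl, hadj⟩)
    have h2 := hf (-1) (r i) (r j) (Or.inr ⟨rfl, hadj.ne⟩)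
    simp only [Units.val_one, Units.val_neg, one_mul, neg_mul] at h1 h2
    rcases Int.natAbs_eq_natAbs_iff.1 hij with h3 | h3
    · exact h1 h3
    · exact h2 h3
  have := Finset.card_le_card_of_injOn (t := Finset.Icc 1 m) _ (fun i _ => by
    have := hfL (r i)
    simp only [Finset.coe_Icc, Set.mem_Icc]
    omega) hinj
  simpa using this

end SimpleGraph.IsCompletePartite

theorem theorem1p6 {V : Type*} [Fintype V] (G : SimpleGraph V) (k : ℕ)
    (hG : G.IsCompletePartite k) (hV : Fintype.card V ≤ 2 * k + 1) :
    G.completeExpansion.zeroFreeListChromaticNumber = ((2 * k : ℕ) : ℕ∞) := by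
  refine le_antisymm (iInf₂_le k (hG.isZeroFreeChoosable_completeExpansion hV)) ?_
  refine le_iInf₂ fun m hm => ?_
  have := hG.le_of_isZeroFreeChoosable_completeExpansion hm
  exact_mod_cast Nat.mul_le_mul_left 2 this
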